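/- Let $p$ be a prime number, $q$ a power of $p$ (with exponent at least $1$), and $\mathbb{F}_q((T^{-1}))$ the field of formal power series $\xi=\sum_{m\ge N}a_mT^{-m}$ ($N\in\mathbb{Z}$, $a_m\in\mathbb{F}_q$) over the field $\mathbb{F}_q$ with $q$ elements, with the absolute value $|0|=0$ and $|\xi|=q^{-N}$ if $a_N\neq 0$. The height $H(P)$ of a polynomial $P(X)$ with coefficients in $\mathbb{F}_q[T]$ is the maximum of the absolute values of its coefficients. An element $\alpha$ of $\mathbb{F}_q((T^{-1}))$ is algebraic if it is a root of a nonzero polynomial with coefficients in $\mathbb{F}_q[T]$; its degree and its height $H(\alpha)$ are the degree and the height of its minimal defining polynomial over $\mathbb{F}_q[T]$ (the primitive polynomial of least degree vanishing at $\alpha$, unique up to a factor in $\mathbb{F}_q^{\times}$). For $\xi\in\mathbb{F}_q((T^{-1}))$ and an integer $n\ge 1$, let $w_n(\xi)\in\mathbb{R}\cup\{\pm\infty\}$ be the supremum of the real numbers $w$ for which $$0<|P(\xi)|<H(P)^{-w}$$ has infinitely many solutions in polynomials $P(X)$ over $\mathbb{F}_q[T]$ of degree at most $n$, and let $w_n^*(\xi)\in\mathbb{R}\cup\{\pm\infty\}$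 be the supremum of the real numbers $w^*$ for which $$0<|\xi-\alpha|<H(\alpha)^{-w^*-1}$$ has infinitely many solutions in algebraic $\alpha\in\mathbb{F}_q((T^{-1}))$ of degree at most $n$. Theorem. For every $\xi\in\mathbb{F}_q((T^{-1}))$ and every integer $n\ge 1$, $$w_n(\xi)=w_n(\xi^p)\quad\text{and}\quad w_n^*(\xi)=w_n^*(\xi^p).$$ -/

import Mathlib

open scoped Polynomial

noncomputable section

namespace MahlerKoksma

variable {F : Type*} [Field F]

/-- The element `T` of the field `F((T⁻¹))` of formal power series in `T⁻¹` over `F`. This field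
is realised as Mathlib's `LaurentSeries F`, whose uniformizer plays the role of `T⁻¹`: the
coefficient of index `n` of a series is the coefficient of `T⁻ⁿ`. -/
def varT (F : Type*) [Field F] : LaurentSeries F := HahnSeries.single (-1 : ℤ) (1 : F)

/-- The inclusion of the polynomial ring `F[T]` in `F((T⁻¹))`. -/
def incl (F : Type*) [Field F] : F[X] →+* LaurentSeries F :=
  Polynomial.eval₂RingHom (HahnSeries.C : F →+* LaurentSeries F) (varT F)

theorem coeff_incl (R : F[X]) (i : ℕ) : (incl F R).coeff (-(i : ℤ)) = R.coeff i := by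
  have h : incl F R =
      ∑ j ∈ R.support, (HahnSeries.single (-(j : ℤ)) (R.coeff j) : LaurentSeries F) := by
    rw [incl, Polynomial.coe_eval₂RingHom, Polynomial.eval₂_eq_sum, Polynomial.sum_def]
    refine Finset.sum_congr rfl fun j _ => ?_
    rw [varT, HahnSeries.single_pow, HahnSeries.C_apply, HahnSeries.single_mul_single]
    simp
  rw [h, HahnSeries.coeff_sum]
  simp only [HahnSeries.coeff_single, neg_inj, Nat.cast_inj]
  simp +contextual [eq_comm]

theorem incl_injective : Function.Injective (incl F) := fun R S h => by
  ext i
  rw [← coeff_incl, ← coeff_incl, h]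

/-- The absolute value on `F((T⁻¹))`, for a finite field `F` with `q` elements: `|0| = 0`, and
`|ξ| = q ^ (-N)` if `ξ = ∑_{n ≥ N} a_n T⁻ⁿ` with `a_N ≠ 0`. -/
def absVal (ξ : LaurentSeries F) : ℝ :=
  open Classical in if ξ = 0 then 0 else (Nat.card F : ℝ) ^ (-ξ.order)

/-- The value `P(ξ)` at `ξ` in `F((T⁻¹))` of a polynomial `P(X)` with coefficients in `F[T]`. -/
def evalAt (P : F[X][X]) (ξ : LaurentSeries F) : LaurentSeries F :=
  P.eval₂ (incl F) ξ

/-- The (naive) height `H(P)` of a polynomial `P(X)` over `F[T]`: the maximum of the absolute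
values of its coefficients. -/
def height (P : F[X][X]) : ℝ :=
  (Finset.range (P.natDegree + 1)).sup' Finset.nonempty_range_add_one
    fun i => absVal (incl F (P.coeff i))

/-- `P` is a minimal defining polynomial of `α` over `F[T]`: a primitive polynomial over `F[T]`
vanishing at `α`, of least degree among all nonzero polynomials over `F[T]` vanishing at `α`.
It exists exactly when `α` is algebraic, and it is then unique up to a factor in `Fˣ`. -/
structure IsMinimalPolynomial (α : LaurentSeries F) (P : F[X][X]) : Prop where
  isPrimitive : P.IsPrimitive
  evalAt_eq_zero : evalAt P α = 0
  natDegree_le : ∀ Q : F[X][X], Q ≠ 0 → evalAt Q α = 0 → P.natDegree ≤ Q.natDegree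

/-- Every algebraic `α` has a minimal defining polynomial. -/
theorem exists_isMinimalPolynomial {α : LaurentSeries F}
    (h : ∃ P : F[X][X], P ≠ 0 ∧ evalAt P α = 0) : ∃ P, IsMinimalPolynomial α P := by
  classical
  obtain ⟨P, ⟨hP0, hP⟩, hmin⟩ := exists_minimalFor_of_wellFoundedLT
    (fun P : F[X][X] => P ≠ 0 ∧ evalAt P α = 0) Polynomial.natDegree h
  let _ : NormalizedGCDMonoid F[X] := Classical.choice inferInstance
  refine ⟨P.primPart, P.isPrimitive_primPart,
    Polynomial.eval₂_primPart_eq_zero incl_injective hP0 hP, fun Q hQ0 hQ => ?_⟩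
  rw [P.natDegree_primPart]
  exact (le_total _ _).elim id (hmin ⟨hQ0, hQ⟩)

/-- Minimal defining polynomials are unique up to a unit, that is, up to a factor in `Fˣ`. -/
theorem IsMinimalPolynomial.associated {α : LaurentSeries F} {P Q : F[X][X]}
    (hP : IsMinimalPolynomial α P) (hQ : IsMinimalPolynomial α Q) : Associated P Q := by
  have key : ∀ {P Q : F[X][X]}, IsMinimalPolynomial α P → IsMinimalPolynomial α Q → P ∣ Q := by
    intro P Q hP hQ
    have hP0 := hP.isPrimitive.ne_zero
    have hQ0 := hQ.isPrimitive.ne_zero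
    have hd : P.natDegree = Q.natDegree :=
      le_antisymm (hP.natDegree_le Q hQ0 hQ.evalAt_eq_zero)
        (hQ.natDegree_le P hP0 hP.evalAt_eq_zero)
    have hpos : 0 < P.natDegree := by
      rcases Nat.eq_zero_or_pos P.natDegree with h | h
      · have h1 := hP.evalAt_eq_zero
        rw [Polynomial.eq_C_of_natDegree_eq_zero h, evalAt, Polynomial.eval₂_C] at h1
        rw [map_eq_zero_iff _ incl_injective] at h1
        rw [Polynomial.eq_C_of_natDegree_eq_zero h, h1] at hP0
        simp at hP0
      · exact h
    have hR : Polynomial.C P.leadingCoeff * Q - Polynomial.C Q.leadingCoeff * P = 0 := by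
      by_contra hR0
      have h1 := hP.natDegree_le _ hR0 (by
        have e1 := hP.evalAt_eq_zero
        have e2 := hQ.evalAt_eq_zero
        simp only [evalAt] at e1 e2 ⊢
        rw [Polynomial.eval₂_sub, Polynomial.eval₂_mul, Polynomial.eval₂_mul, e1, e2]
        simp)
      have h2 : (Polynomial.C P.leadingCoeff * Q - Polynomial.C Q.leadingCoeff * P).natDegree
          ≤ P.natDegree - 1 := by
        refine (Polynomial.natDegree_le_iff_coeff_eq_zero).2 fun N hN => ?_
        rcases Nat.lt_or_ge P.natDegree N with h | h
        · rw [Polynomial.coeff_sub, Polynomial.coeff_C_mul, Polynomial.coeff_C_mul,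
            Polynomial.coeff_eq_zero_of_natDegree_lt h,
            Polynomial.coeff_eq_zero_of_natDegree_lt (hd ▸ h)]
          simp
        · have hN' : N = P.natDegree := by omega
          subst hN'
          rw [Polynomial.coeff_sub, Polynomial.coeff_C_mul, Polynomial.coeff_C_mul]
          rw [Polynomial.coeff_natDegree, hd, Polynomial.coeff_natDegree]
          ring
      omega
    have hlc : P.leadingCoeff ≠ 0 := Polynomial.leadingCoeff_ne_zero.2 hP0
    have hdvd : P ∣ Polynomial.C P.leadingCoeff * Q :=
      ⟨Polynomial.C Q.leadingCoeff, by rw [sub_eq_zero.1 hR, mul_comm]⟩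
    rw [hP.isPrimitive.dvd_iff_fraction_map_dvd_fraction_map (K := FractionRing F[X])]
    have := Polynomial.map_dvd (algebraMap F[X] (FractionRing F[X])) hdvd
    rw [Polynomial.map_mul, Polynomial.map_C] at this
    refine (IsUnit.dvd_mul_left ?_).1 this
    rw [Polynomial.isUnit_C, isUnit_iff_ne_zero]
    simpa using hP0
  exact associated_of_dvd_dvd (key hP hQ) (key hQ hP)

/-- The exponent `w_n(ξ)`, as an extended real number: the supremum of the real numbers `w` for
which `0 < |P(ξ)| < H(P) ^ (-w)` has infinitely many solutions in polynomials `P(X)` over `F[T]`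
of degree at most `n`. -/
def wExp (n : ℕ) (ξ : LaurentSeries F) : EReal :=
  sSup ((fun w : ℝ => (w : EReal)) '' {w : ℝ |
    {P : F[X][X] | P.natDegree ≤ n ∧ 0 < absVal (evalAt P ξ) ∧
      absVal (evalAt P ξ) < height P ^ (-w)}.Infinite})

/-- The exponent `w_n^*(ξ)`, as an extended real number: the supremum of the real numbers `w` for
which `0 < |ξ - α| < H(α) ^ (-w - 1)` has infinitely many solutions in elements `α` of `F((T⁻¹))`
which are algebraic of degree at most `n`. The degree and the height `H(α)` of `α` are those of
its minimal defining polynomial `P` over `F[T]`; they do not depend on the choice of `P`. -/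
def wStarExp (n : ℕ) (ξ : LaurentSeries F) : EReal :=
  sSup ((fun w : ℝ => (w : EReal)) '' {w : ℝ |
    {α : LaurentSeries F | ∃ P : F[X][X], IsMinimalPolynomial α P ∧ P.natDegree ≤ n ∧
      0 < absVal (ξ - α) ∧ absVal (ξ - α) < height P ^ (-w - 1)}.Infinite})

end MahlerKoksma

end

noncomputable section

namespace MahlerKoksma

/-! ### The absolute value on series and its extension to the algebraic closure -/

section Extension

variable {F : Type*} [Field F]

open scoped NNReal WithZero

/-! Raising coefficients to the `p`-th power turns `P` into a polynomial `P'` with `P'(ξ^p) =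
P(ξ)^p` and height `H(P)^p`, and `α` into `α^p`. This carries good approximations of `ξ` to `ξ^p`
with the same exponent and gives both inequalities `≤`.

Conversely, `F[T]` has basis `1, T, …, T^(p-1)` over its `p`-th powers, so `P = ∑ T^i Q_i'`, and
each Taylor coefficient of `P` at `ξ^p` is `∑ T^i d_i^p`, where `d_i` is the corresponding
coefficient of `Q_i` at `ξ` (`coeff_shift_pow`). The nonzero terms have degrees in distinct classes
mod `p`, so nothing cancels: `H(Q_i)^p ≤ H(P)` and `|Q_i(ξ)|^p ≤ |P(ξ^p)|`. This settles `w_n`.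

For `w_n^*`, a component `Q_i` must have a root close to `ξ`. The condition that transfers is
`NewtonSimple`: the Newton polygon at the point has a vertex at `1`. There is then a unique closest
root; it lies in the series field because it is its own only conjugate, and its distance is `|f_0| /
|f_1|`. The inequalities are homogeneous, so they pass to the component that dominates the linear
coefficient (`exists_newtonSimple_component`).

It remains to produce such polynomials for `ζ = ξ^p` when `ζ` is not algebraic of degree at most `n`
(`exists_newtonSimple_of_infinite`). If the minimal polynomial `P` of an approximation `α` has no
vertex at `1`, then `|P(ζ)|` is quadratically small in `|ζ - α|`. Wirsing's method then compares `P`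
with a Dirichlet polynomial coprime to it: their nonzero resultant has absolute value at least `1`,
which forces the polynomial owning the root nearest to `ζ` to have the vertex. Exponents below
`(n-1)/2` are obtained by the same method from any irreducible polynomials with small values.

If `ξ` is algebraic of degree at most `n`, the chain `w_n^*(ξ^p) ≤ w_n(ξ^p) ≤ w_n(ξ) ≤ w_n^*(ξ)` is
used. For its last step a multiple of the minimal polynomial of `ξ` is added to `P`: the value at
`ξ` is unchanged, while the derivative becomes large because `ξ` is separable. -/

theorem one_lt_card [Finite F] : (1 : ℝ) < Nat.card F := by
  exact_mod_cast Finite.one_lt_card (α := F)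

theorem one_lt_card_nnreal [Finite F] : (1 : ℝ≥0) < Nat.card F := by
  exact_mod_cast Finite.one_lt_card (α := F)

theorem valuation_eq_exp_order {ξ : LaurentSeries F} (h : ξ ≠ 0) :
    (Valued.v ξ : ℤᵐ⁰) = WithZero.exp (-ξ.order) := by
  have h0 : (Valued.v ξ : ℤᵐ⁰) ≠ 0 := by simpa using h
  refine le_antisymm ((LaurentSeries.valuation_le_iff_coeff_lt_eq_zero F).2 fun n hn =>
    HahnSeries.coeff_eq_zero_of_lt_order hn) ?_
  by_contra! hlt
  have h1 : (Valued.v ξ : ℤᵐ⁰) ≤ WithZero.exp (-(ξ.order + 1)) := by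
    rw [← WithZero.exp_log h0] at hlt ⊢
    rw [WithZero.exp_lt_exp] at hlt
    rw [WithZero.exp_le_exp]
    omega
  have h2 := (LaurentSeries.valuation_le_iff_coeff_lt_eq_zero F).1 h1 ξ.order (by omega)
  exact h (HahnSeries.coeff_order_eq_zero.1 h2)

/-- The rank one structure on the `T⁻¹`-adic valuation for which the norm is `absVal`. -/
@[reducible]
def rankOneValuation (F : Type*) [Field F] [Finite F] :
    (Valued.v : Valuation (LaurentSeries F) ℤᵐ⁰).RankOne where
  hom' := (WithZeroMulInt.toNNReal (one_lt_card_nnreal (F := F)).ne_zero).comp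
    MonoidWithZeroHom.ValueGroup₀.embedding
  strictMono' := (WithZeroMulInt.toNNReal_strictMono (one_lt_card_nnreal (F := F))).comp
    MonoidWithZeroHom.ValueGroup₀.embedding_strictMono
  exists_val_nontrivial := by
    refine ⟨HahnSeries.single 1 1, ?_, ?_⟩
    · simp
    · rw [valuation_eq_exp_order (by simp), HahnSeries.order_single one_ne_zero, ← WithZero.exp_zero,
        Ne, WithZero.exp_inj]
      decide

/-- The field `F((T⁻¹))` as a nontrivially normed field. -/
@[reducible]
def nontriviallyNormedField (F : Type*) [Field F] [Finite F] :
    NontriviallyNormedField (LaurentSeries F) :=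
  let _ := rankOneValuation F
  Valued.toNontriviallyNormedField (L := LaurentSeries F) (Γ₀ := ℤᵐ⁰)

/-- The bridge by which multiplicativity, the ultrametric inequality and completeness are inherited
from the valued field of Laurent series. -/
theorem norm_eq_absVal [Finite F] (ξ : LaurentSeries F) :
    (nontriviallyNormedField F).toNormedField.norm ξ = absVal ξ := by
  let _ := rankOneValuation F
  change ((WithZeroMulInt.toNNReal (one_lt_card_nnreal (F := F)).ne_zero
    (MonoidWithZeroHom.ValueGroup₀.embedding (Valued.v.restrict ξ)) : ℝ≥0) : ℝ) = _
  rw [Valuation.embedding_restrict, absVal]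
  split_ifs with h
  · simp [h]
  · rw [valuation_eq_exp_order h, WithZeroMulInt.toNNReal_neg_apply _ (by simp)]
    simp only [WithZero.exp, NNReal.coe_zpow, NNReal.coe_natCast]
    rfl

/-- The absolute value `absVal` as a bundled absolute value. -/
def absAV (F : Type*) [Field F] [Finite F] : AbsoluteValue (LaurentSeries F) ℝ where
  toFun := absVal
  map_mul' x y := by
    let _ := nontriviallyNormedField F
    simp only [← norm_eq_absVal]
    exact norm_mul x y
  nonneg' x := by
    let _ := nontriviallyNormedField F
    simp only [← norm_eq_absVal]
    exact norm_nonneg x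
  eq_zero' x := by
    let _ := nontriviallyNormedField F
    simp only [← norm_eq_absVal]
    exact norm_eq_zero
  add_le' x y := by
    let _ := nontriviallyNormedField F
    simp only [← norm_eq_absVal]
    exact norm_add_le x y

theorem absAV_apply [Finite F] (ξ : LaurentSeries F) : absAV F ξ = absVal ξ := rfl

theorem isNonarchimedean_absAV [Finite F] : IsNonarchimedean (absAV F) := by
  intro x y
  let _ := rankOneValuation F
  have := Valued.isNonarchimedean_norm (L := LaurentSeries F) (Γ₀ := ℤᵐ⁰) x y
  simp only [absAV_apply, ← norm_eq_absVal]
  exact this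

/-- `absVal` extends to an absolute value of the algebraic closure, constant on conjugates. -/
theorem exists_absoluteValue_algebraicClosure (F : Type*) [Field F] [Finite F] :
    ∃ v : AbsoluteValue (AlgebraicClosure (LaurentSeries F)) ℝ, IsNonarchimedean v ∧
      (∀ x : LaurentSeries F, v (algebraMap _ _ x) = absAV F x) ∧
      ∀ x y, minpoly (LaurentSeries F) x = minpoly (LaurentSeries F) y → v x = v y := by
  let _ := rankOneValuation F
  let _ := nontriviallyNormedField F
  have : IsUltrametricDist (LaurentSeries F) :=
    Valued.instIsUltrametricDist (L := LaurentSeries F) (Γ₀ := ℤᵐ⁰)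
  -- Completeness makes the spectral norm multiplicative. It is defined from the minimal polynomial
  -- alone, hence constant on conjugates.
  have : CompleteSpace (LaurentSeries F) := LaurentSeries.instLaurentSeriesComplete
  let f := spectralMulAlgNorm (LaurentSeries F) (AlgebraicClosure (LaurentSeries F))
  refine ⟨⟨⟨f, map_mul f⟩, apply_nonneg f, fun x => map_eq_zero_iff_eq_zero f, map_add_le_add f⟩,
    isNonarchimedean_spectralNorm, fun x => ?_, fun x y h => ?_⟩
  · rw [absAV_apply, ← norm_eq_absVal]
    exact spectralNorm_extends x
  · change spectralNorm _ _ x = spectralNorm _ _ y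
    rw [spectralNorm, spectralNorm, h]

end Extension

/-! ### Newton polygons with a vertex at `1` and their smallest root -/

section Newton

open Polynomial

variable {K : Type*} [Field K]

/-- The Newton polygon of `f` has a vertex at `1`: it has a unique root of least absolute value. -/
def NewtonSimple (v : AbsoluteValue K ℝ) (f : K[X]) : Prop :=
  f.coeff 1 ≠ 0 ∧ ∀ k, 2 ≤ k → v (f.coeff k) * v (f.coeff 0) ^ (k - 1) < v (f.coeff 1) ^ k

variable {v : AbsoluteValue K ℝ}

theorem add_le_of_le (hv : IsNonarchimedean v) {x y : K} {r : ℝ} (hx : v x ≤ r) (hy : v y ≤ r) :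
    v (x + y) ≤ r := (hv x y).trans (max_le hx hy)

theorem sub_le_of_le (hv : IsNonarchimedean v) {x y : K} {r : ℝ} (hx : v x ≤ r) (hy : v y ≤ r) :
    v (x - y) ≤ r := by
  rw [sub_eq_add_neg]; exact add_le_of_le hv hx (by rwa [v.map_neg])

theorem add_eq_left_of_lt (hv : IsNonarchimedean v) {x y : K} (h : v y < v x) :
    v (x + y) = v x := by
  rw [hv.add_eq_max_of_ne h.ne', max_eq_left h.le]

theorem sum_lt_of_lt (hv : IsNonarchimedean v) {ι : Type*} (s : Finset ι) (f : ι → K) {r : ℝ}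
    (hr : 0 < r) (h : ∀ i ∈ s, v (f i) < r) : v (∑ i ∈ s, f i) < r := by
  classical
  induction s using Finset.induction_on with
  | empty => simpa
  | insert a s ha ih =>
    rw [Finset.sum_insert ha]
    exact (hv _ _).trans_lt (max_lt (h a (by simp)) (ih fun i hi => h i (by simp [hi])))

theorem sum_le_of_le (hv : IsNonarchimedean v) {ι : Type*} (s : Finset ι) (f : ι → K) {r : ℝ}
    (hr : 0 ≤ r) (h : ∀ i ∈ s, v (f i) ≤ r) : v (∑ i ∈ s, f i) ≤ r := by
  classical
  induction s using Finset.induction_on with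
  | empty => simpa
  | insert a s ha ih =>
    rw [Finset.sum_insert ha]
    exact add_le_of_le hv (h a (by simp)) (ih fun i hi => h i (by simp [hi]))

theorem coeff_X_sub_C_mul_succ (z : K) (g : K[X]) (k : ℕ) :
    ((X - C z) * g).coeff (k + 1) = g.coeff k - z * g.coeff (k + 1) := by
  rw [sub_mul, coeff_sub, coeff_X_mul, coeff_C_mul]

theorem coeff_X_sub_C_mul_zero (z : K) (g : K[X]) :
    ((X - C z) * g).coeff 0 = -(z * g.coeff 0) := by
  rw [sub_mul, coeff_sub, coeff_C_mul]; simp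

/-- A polynomial whose roots have absolute value greater than `r` is dominated by its constant
term on the disc of radius `r`. -/
theorem coeff_prod_mul_pow_lt (hv : IsNonarchimedean v) {r : ℝ} (hr : 0 ≤ r) (s : Multiset K)
    (hs : ∀ z ∈ s, r < v z) {c : K} (hc : c ≠ 0) :
    (C c * (s.map fun z => X - C z).prod).coeff 0 ≠ 0 ∧ ∀ j,
      v ((C c * (s.map fun z => X - C z).prod).coeff (j + 1)) * r ^ (j + 1) <
        v ((C c * (s.map fun z => X - C z).prod).coeff 0) := by
  induction s using Multiset.induction_on with
  | empty => simpa [coeff_C] using hc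
  | cons z s ih =>
    obtain ⟨h0, hj⟩ := ih fun w hw => hs w (Multiset.mem_cons_of_mem hw)
    have hz : r < v z := hs z (Multiset.mem_cons_self z s)
    have hz0 : 0 < v z := hr.trans_lt hz
    rw [Multiset.map_cons, Multiset.prod_cons, mul_left_comm]
    generalize C c * (s.map fun z => X - C z).prod = g at h0 hj ⊢
    have hz0' : z ≠ 0 := fun h => by simp [h] at hz0
    have hg0 : 0 < v (g.coeff 0) := v.pos h0
    refine ⟨by rw [coeff_X_sub_C_mul_zero]; simp [h0, hz0'], fun j => ?_⟩
    rw [coeff_X_sub_C_mul_zero, coeff_X_sub_C_mul_succ, v.map_neg, v.map_mul]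
    have h1 : v (g.coeff (j + 1)) * r ^ (j + 1) < v (g.coeff 0) := hj j
    have h2 : v (g.coeff j) * r ^ j ≤ v (g.coeff 0) := by
      cases j with
      | zero => simp
      | succ j => exact (hj j).le
    have hb : v (g.coeff j - z * g.coeff (j + 1)) * r ^ (j + 1) ≤
        max (v (g.coeff j) * r ^ (j + 1)) (v z * (v (g.coeff (j + 1)) * r ^ (j + 1))) := by
      rw [sub_eq_add_neg, ← mul_assoc, ← max_mul_of_nonneg _ _ (by positivity)]
      refine mul_le_mul_of_nonneg_right ((hv _ _).trans ?_) (by positivity)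
      rw [v.map_neg, v.map_mul]
    refine hb.trans_lt (max_lt ?_ ?_)
    · calc v (g.coeff j) * r ^ (j + 1) = r * (v (g.coeff j) * r ^ j) := by ring
        _ ≤ r * v (g.coeff 0) := by gcongr
        _ < v z * v (g.coeff 0) := by gcongr
    · gcongr

/-- In `(X - z) g` with every root of `g` larger than `z`, the constant term of `g` dominates on the
disc of radius `|z|`. Hence the linear coefficient has size `|g_0|`, the constant one `|z| |g_0|`,
and the higher ones are too small to matter. -/
theorem newtonSimple_of_lt (hv : IsNonarchimedean v) {z : K} (s : Multiset K)
    (hs : ∀ w ∈ s, v z < v w) {c : K} (hc : c ≠ 0) :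
    NewtonSimple v (C c * ((z ::ₘ s).map fun z => X - C z).prod) ∧
      v ((C c * ((z ::ₘ s).map fun z => X - C z).prod).coeff 0) =
        v z * v ((C c * ((z ::ₘ s).map fun z => X - C z).prod).coeff 1) := by
  obtain ⟨h0, hj⟩ := coeff_prod_mul_pow_lt hv (v.nonneg z) s hs hc
  rw [Multiset.map_cons, Multiset.prod_cons, mul_left_comm]
  generalize C c * (s.map fun z => X - C z).prod = g at h0 hj ⊢
  have hg0 : 0 < v (g.coeff 0) := v.pos h0
  have e1 : v (((X - C z) * g).coeff 1) = v (g.coeff 0) := by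
    rw [coeff_X_sub_C_mul_succ, sub_eq_add_neg]
    apply add_eq_left_of_lt hv
    have := hj 0
    rw [v.map_neg, v.map_mul, mul_comm]
    simpa using this
  have e0 : v (((X - C z) * g).coeff 0) = v z * v (g.coeff 0) := by
    rw [coeff_X_sub_C_mul_zero, v.map_neg, v.map_mul]
  refine ⟨⟨fun h => ?_, fun k hk => ?_⟩, by rw [e0, e1]⟩
  · rw [h, v.map_zero] at e1; exact hg0.ne e1
  · obtain ⟨k, rfl⟩ := Nat.exists_eq_add_of_le' hk
    rw [e0, e1, show k + 2 - 1 = k + 1 by omega, mul_pow, ← mul_assoc, pow_succ _ (k + 1), mul_comm (_ ^ (k + 1)) (v (g.coeff 0))]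
    refine mul_lt_mul_of_pos_right ?_ (by positivity)
    have h1 := hj k
    have h2 := hj (k + 1)
    rw [coeff_X_sub_C_mul_succ]
    have hb : v (g.coeff (k + 1) - z * g.coeff (k + 1 + 1)) * v z ^ (k + 1) ≤
        max (v (g.coeff (k + 1)) * v z ^ (k + 1))
          (v (g.coeff (k + 1 + 1)) * v z ^ (k + 1 + 1)) := by
      rw [sub_eq_add_neg, pow_succ' _ (k + 1), mul_left_comm, ← mul_assoc (v z),
        ← max_mul_of_nonneg _ _ (by positivity)]
      refine mul_le_mul_of_nonneg_right ((hv _ _).trans ?_) (by positivity)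
      rw [v.map_neg, v.map_mul]
    exact hb.trans_lt (max_lt h1 h2)

theorem NewtonSimple.coeff_one_pos {f : K[X]} (hf : NewtonSimple v f) : 0 < v (f.coeff 1) :=
  v.pos hf.1

/-- The defining inequalities in terms of a radius `r ≤ |f 0| / |f 1|`. -/
theorem NewtonSimple.coeff_mul_pow_lt {f : K[X]} (hf : NewtonSimple v f) {r : ℝ} (hr : 0 ≤ r)
    (h : v (f.coeff 1) * r ≤ v (f.coeff 0)) (k : ℕ) :
    v (f.coeff (k + 2)) * r ^ (k + 1) < v (f.coeff 1) := by
  have h1 := hf.2 (k + 2) (by omega)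
  have hp := hf.coeff_one_pos
  have h2 : (v (f.coeff 1) * r) ^ (k + 1) ≤ v (f.coeff 0) ^ (k + 1) := by gcongr
  rw [show k + 2 - 1 = k + 1 by omega] at h1
  by_contra! hc
  have : v (f.coeff 1) * v (f.coeff 1) ^ (k + 1) ≤
      (v (f.coeff (k + 2)) * r ^ (k + 1)) * v (f.coeff 1) ^ (k + 1) := by gcongr
  have h3 : v (f.coeff (k + 2)) * (v (f.coeff 1) * r) ^ (k + 1) ≤
    v (f.coeff (k + 2)) * v (f.coeff 0) ^ (k + 1) := by gcongr
  rw [pow_succ' _ (k+1)] at h1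
  rw [mul_pow] at h3
  nlinarith

theorem eval_eq_zero_add_one_add_sum (f : K[X]) (y : K) :
    f.eval y = f.coeff 0 + (f.coeff 1 * y +
      ∑ k ∈ Finset.range f.natDegree, f.coeff (k + 2) * y ^ (k + 2)) := by
  rw [eval_eq_sum_range' (n := f.natDegree + 2) (by omega), Finset.sum_range_succ',
    Finset.sum_range_succ']
  simp
  ring

/-- For a smaller `y` the constant term would strictly dominate all other terms of `f(y)`, which
could not vanish. -/
theorem NewtonSimple.coeff_zero_le {f : K[X]} (hv : IsNonarchimedean v) (hf : NewtonSimple v f)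
    {y : K} (hy : f.eval y = 0) : v (f.coeff 0) ≤ v (f.coeff 1) * v y := by
  by_contra! hlt
  have hf0 : 0 < v (f.coeff 0) := lt_of_le_of_lt (by positivity) hlt
  rw [eval_eq_zero_add_one_add_sum] at hy
  have h : v (f.coeff 1 * y + ∑ k ∈ Finset.range f.natDegree, f.coeff (k + 2) * y ^ (k + 2)) <
      v (f.coeff 0) := by
    refine (hv _ _).trans_lt (max_lt (by rwa [v.map_mul]) (sum_lt_of_lt hv _ _ hf0 fun k _ => ?_))
    have h1 := hf.coeff_mul_pow_lt (v.nonneg y) hlt.le k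
    rw [v.map_mul, v.map_pow, pow_succ, ← mul_assoc]
    refine lt_of_le_of_lt ?_ hlt
    gcongr
  have h2 := add_eq_left_of_lt hv h
  rw [hy, v.map_zero] at h2
  exact hf0.ne h2

/-- The cofactor of the smallest root has no root of absolute value at most `|f 0| / |f 1|`. -/
theorem NewtonSimple.lt_of_isRoot_cofactor {z : K} {g : K[X]} (hv : IsNonarchimedean v)
    (hf : NewtonSimple v ((X - C z) * g))
    (hz : v (((X - C z) * g).coeff 1) * v z ≤ v (((X - C z) * g).coeff 0))
    {y : K} (hy : g.eval y = 0) :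
    v (((X - C z) * g).coeff 0) < v (((X - C z) * g).coeff 1) * v y := by
  by_contra! hle
  have hp := hf.coeff_one_pos
  set r := max (v z) (v y) with hr
  have hr0 : 0 ≤ r := (v.nonneg z).trans (le_max_left _ _)
  have hrf : v (((X - C z) * g).coeff 1) * r ≤ v (((X - C z) * g).coeff 0) := by
    rcases max_choice (v z) (v y) with h | h <;> rw [hr, h] <;> assumption
  have key := hf.coeff_mul_pow_lt hr0 hrf
  -- Descending induction on `k`, carried by `m`: beyond the degree of `g` the coefficient is zero,
  -- and `g_(k+1) = f_(k+2) + z g_(k+2)` descends.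
  have hg : ∀ m k, g.natDegree + 1 ≤ k + m →
      v (g.coeff (k + 1)) * r ^ (k + 1) < v (((X - C z) * g).coeff 1) := by
    intro m
    induction m with
    | zero =>
      intro k hk
      rw [coeff_eq_zero_of_natDegree_lt (by omega)]
      simpa using hp
    | succ m ih =>
      intro k hk
      have h1 := ih (k + 1) (by omega)
      have h2 := key k
      have e : g.coeff (k + 1) = ((X - C z) * g).coeff (k + 2) + z * g.coeff (k + 1 + 1) := by
        rw [coeff_X_sub_C_mul_succ]; ring
      have hb : v (g.coeff (k + 1)) * r ^ (k + 1) ≤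
          max (v (((X - C z) * g).coeff (k + 2)) * r ^ (k + 1))
            (v (g.coeff (k + 1 + 1)) * r ^ (k + 1 + 1)) := by
        rw [e, pow_succ' _ (k + 1), mul_left_comm, ← mul_assoc r,
          ← max_mul_of_nonneg _ _ (by positivity)]
        refine mul_le_mul_of_nonneg_right ((hv _ _).trans ?_) (by positivity)
        rw [v.map_mul]
        gcongr
        exact le_max_left _ _
      exact hb.trans_lt (max_lt h2 h1)
  have hg' : ∀ k, v (g.coeff (k + 1)) * r ^ (k + 1) < v (((X - C z) * g).coeff 1) :=
    fun k => hg (g.natDegree + 1) k (by omega)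
  -- So the constant term of `g` has size `|f_1|` and dominates every other term of `g(y) = 0`, a
  -- contradiction.
  have e0 : v (g.coeff 0) = v (((X - C z) * g).coeff 1) := by
    have e : g.coeff 0 = ((X - C z) * g).coeff 1 + z * g.coeff 1 := by
      rw [coeff_X_sub_C_mul_succ]; ring
    rw [e]
    refine add_eq_left_of_lt hv (lt_of_le_of_lt ?_ (hg' 0))
    rw [v.map_mul, mul_comm]
    simp only [zero_add, pow_one]
    gcongr
    exact le_max_left _ _
  rw [eval_eq_sum_range' (n := g.natDegree + 1) (by omega), Finset.sum_range_succ'] at hy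
  have hlt : v (∑ k ∈ Finset.range g.natDegree, g.coeff (k + 1) * y ^ (k + 1)) <
      v (g.coeff 0 * y ^ 0) := by
    rw [pow_zero, mul_one, e0]
    refine sum_lt_of_lt hv _ _ hp fun k _ => lt_of_le_of_lt ?_ (hg' k)
    rw [v.map_mul, v.map_pow]
    gcongr
    exact le_max_right _ _
  have h2 := add_eq_left_of_lt hv hlt
  rw [add_comm, hy, v.map_zero, pow_zero, mul_one, e0] at h2
  exact hp.ne h2

/-- If all roots exceeded `r = |f_0| / |f_1|`, domination on the disc of radius `r` would give
`|f_1| r < |f_0|`. -/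
theorem NewtonSimple.exists_root_le {f : K[X]} (hv : IsNonarchimedean v) (hf : NewtonSimple v f)
    (hs : f.Splits) : ∃ z, f.eval z = 0 ∧ v (f.coeff 1) * v z ≤ v (f.coeff 0) := by
  have hp := hf.coeff_one_pos
  have hf0 : f ≠ 0 := fun h => hf.1 (by simp [h])
  by_contra! hall
  have h := coeff_prod_mul_pow_lt hv (r := v (f.coeff 0) / v (f.coeff 1)) (by positivity) f.roots
    (fun z hz => by rw [div_lt_iff₀' hp]; exact hall z (isRoot_of_mem_roots hz))
    (leadingCoeff_ne_zero.2 hf0)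
  rw [← hs.eq_prod_roots] at h
  have := h.2 0
  rw [zero_add, pow_one, mul_div_cancel₀ _ hp.ne'] at this
  exact this.false

theorem newtonSimple_map {L : Type*} [Field L] (φ : K →+* L) {w : AbsoluteValue L ℝ}
    (hw : ∀ x, w (φ x) = v x) {f : K[X]} : NewtonSimple w (f.map φ) ↔ NewtonSimple v f := by
  simp [NewtonSimple, hw]

/-- A polynomial whose Newton polygon has a vertex at `1` has a root in the base field. -/
theorem NewtonSimple.exists_root {L : Type*} [Field L] [Algebra K L] [IsAlgClosed L]
    [Algebra.IsAlgebraic K L] {w : AbsoluteValue L ℝ} (hw : IsNonarchimedean w)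
    (hext : ∀ x : K, w (algebraMap K L x) = v x)
    (hconj : ∀ x y : L, minpoly K x = minpoly K y → w x = w y)
    {f : K[X]} (hf : NewtonSimple v f) :
    ∃ y, f.eval y = 0 ∧ v (f.coeff 1) * v y = v (f.coeff 0) := by
  have hv : IsNonarchimedean v := fun x y => by
    simpa only [← hext, map_add] using hw (algebraMap K L x) (algebraMap K L y)
  suffices h : ∃ y, f.eval y = 0 ∧ v (f.coeff 1) * v y ≤ v (f.coeff 0) by
    obtain ⟨y, h1, h2⟩ := h
    exact ⟨y, h1, h2.antisymm (hf.coeff_zero_le hv h1)⟩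
  have hF : NewtonSimple w (f.map (algebraMap K L)) := (newtonSimple_map _ hext).2 hf
  obtain ⟨z, hz0, hz⟩ := hF.exists_root_le hw (IsAlgClosed.splits _)
  obtain ⟨g, hg⟩ := dvd_iff_isRoot.2 hz0
  have hint : IsIntegral K z := Algebra.IsIntegral.isIntegral z
  have hdvd : (minpoly K z).map (algebraMap K L) ∣ (X - C z) * g := by
    rw [← hg]
    refine Polynomial.map_dvd _ (minpoly.dvd K z ?_)
    rwa [eval_map_algebraMap] at hz0
  rw [hg] at hF hz
  have huniq := fun y hy => hF.lt_of_isRoot_cofactor (y := y) hw hz hy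
  -- A conjugate of `z` is as small as `z`, and the cofactor `g` has no root that small.
  have hroots : ∀ y ∈ ((minpoly K z).map (algebraMap K L)).roots, y = z := by
    intro y hy
    have hy0 : ((minpoly K z).map (algebraMap K L)).eval y = 0 := isRoot_of_mem_roots hy
    have hym : minpoly K z = minpoly K y := by
      refine minpoly.eq_of_irreducible_of_monic (minpoly.irreducible hint) ?_ (minpoly.monic hint)
      rwa [eval_map_algebraMap] at hy0
    have h0 := eval_eq_zero_of_dvd_of_eval_eq_zero hdvd hy0
    rw [eval_mul, mul_eq_zero] at h0
    rcases h0 with h0 | h0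
    · simpa [sub_eq_zero] using h0
    · have := huniq y h0
      rw [← hconj z y hym] at this
      exact absurd this (not_lt.2 hz)
  have hmon : ((minpoly K z).map (algebraMap K L)).Monic := (minpoly.monic hint).map _
  have hcard : Multiset.card ((minpoly K z).map (algebraMap K L)).roots = (minpoly K z).natDegree := by
    rw [← (IsAlgClosed.splits _).natDegree_eq_card_roots, natDegree_map]
  have hrep := Multiset.eq_replicate.2 ⟨hcard, hroots⟩
  have heq := (IsAlgClosed.splits ((minpoly K z).map (algebraMap K L))).eq_prod_roots_of_monic hmon
  rw [hrep, Multiset.map_replicate, Multiset.prod_replicate] at heq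
  -- The minimal polynomial is a power of `X - z`. An exponent above `1` (inseparability) would make
  -- `z` a root of `g` as well.
  have hdeg : (minpoly K z).natDegree = 1 := by
    by_contra hne
    have h2 : 2 ≤ (minpoly K z).natDegree := by
      have := minpoly.natDegree_pos hint
      omega
    rw [heq] at hdvd
    have h3 : (X - C z) * (X - C z) ∣ (X - C z) * g := by
      rw [← sq]; exact (pow_dvd_pow _ h2).trans hdvd
    have h4 := (mul_dvd_mul_iff_left (X_sub_C_ne_zero z)).1 h3
    exact absurd (huniq z (dvd_iff_isRoot.1 h4)) (not_lt.2 hz)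
  obtain ⟨y, rfl⟩ := minpoly.mem_range_of_degree_eq_one K z
    (by rw [degree_eq_natDegree (minpoly.ne_zero hint), hdeg]; rfl)
  rw [← hg] at hz
  refine ⟨y, ?_, by simpa [hext] using hz⟩
  rw [eval_map_algebraMap, aeval_algebraMap_apply] at hz0
  simpa using hz0

end Newton

/-! ### Resultants, Mahler measures and small roots -/

section Resultant

open Polynomial

variable {K : Type*} [Field K] (v : AbsoluteValue K ℝ)

/-- `log max(1, |z|)`. -/
def logLarge (z : K) : ℝ := max 0 (Real.log (v z))

/-- `-log min(1, |z|)`. -/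
def logSmall (z : K) : ℝ := max 0 (-Real.log (v z))

/-- The logarithm of `|a| ∏ max(1, |z|)`, for the leading coefficient `a` and the roots `z`. -/
def logMahler (f : K[X]) : ℝ :=
  Real.log (v f.leadingCoeff) + (f.roots.map (logLarge v)).sum

variable {v}

theorem logLarge_sub_logSmall (z : K) : logLarge v z - logSmall v z = Real.log (v z) := by
  unfold logLarge logSmall
  rcases le_total 0 (Real.log (v z)) with h | h
  · rw [max_eq_right h, max_eq_left (by linarith)]; ring
  · rw [max_eq_left h, max_eq_right (by linarith)]; ring

theorem logLarge_nonneg (z : K) : 0 ≤ logLarge v z := le_max_left _ _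

theorem logSmall_nonneg (z : K) : 0 ≤ logSmall v z := le_max_left _ _

theorem logSmall_anti {z w : K} (hz : z ≠ 0) (h : v z ≤ v w) : logSmall v w ≤ logSmall v z :=
  max_le_max le_rfl (neg_le_neg (Real.log_le_log (v.pos hz) h))

/-- The term `min` records the gain over the trivial bound: two elements close to `0` are close to
each other. -/
theorem log_sub_le (hv : IsNonarchimedean v) {z w : K} (h : z ≠ w) :
    Real.log (v (z - w)) ≤ logLarge v z + logLarge v w - min (logSmall v z) (logSmall v w) := by
  have h1 : v (z - w) ≤ max (v z) (v w) := sub_le_of_le hv (le_max_left _ _) (le_max_right _ _)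
  have h2 := Real.log_le_log (v.pos (sub_ne_zero.2 h)) h1
  refine h2.trans ?_
  have ez := logLarge_sub_logSmall (v := v) z
  have ew := logLarge_sub_logSmall (v := v) w
  have nz := logLarge_nonneg (v := v) z
  have nw := logLarge_nonneg (v := v) w
  rcases le_total (v z) (v w) with hle | hle
  · rw [max_eq_right hle, ← ew]
    linarith [min_le_right (logSmall v z) (logSmall v w)]
  · rw [max_eq_left hle, ← ez]
    linarith [min_le_left (logSmall v z) (logSmall v w)]

theorem log_multiset_prod {s : Multiset K} (h : ∀ z ∈ s, z ≠ 0) :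
    Real.log (v s.prod) = (s.map fun z => Real.log (v z)).sum := by
  induction s using Multiset.induction_on with
  | empty => simp
  | cons a s ih =>
    have ha := h a (Multiset.mem_cons_self a s)
    have hs : s.prod ≠ 0 := Multiset.prod_ne_zero fun h0 => h 0 (Multiset.mem_cons_of_mem h0) rfl
    rw [Multiset.prod_cons, v.map_mul, Real.log_mul (v.pos ha).ne' (v.pos hs).ne', Multiset.map_cons,
      Multiset.sum_cons, ih fun z hz => h z (Multiset.mem_cons_of_mem hz)]

theorem log_eval_eq {f : K[X]} (hs : f.Splits) {y : K} (hy : f.eval y ≠ 0) :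
    Real.log (v (f.eval y)) = Real.log (v f.leadingCoeff) +
      (f.roots.map fun z => Real.log (v (y - z))).sum := by
  have hf0 : f ≠ 0 := fun h => hy (by simp [h])
  have e : f.eval y = f.leadingCoeff * (f.roots.map fun z => y - z).prod := by
    conv_lhs => rw [hs.eq_prod_roots]
    rw [eval_mul, eval_C, eval_multiset_prod, Multiset.map_map]
    simp
  have h0 : (f.roots.map fun z => y - z).prod ≠ 0 := fun h => hy (by rw [e, h, mul_zero])
  rw [e, v.map_mul, Real.log_mul (v.pos (leadingCoeff_ne_zero.2 hf0)).ne' (v.pos h0).ne',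
    log_multiset_prod, Multiset.map_map]
  · rfl
  · intro z hz h
    rw [h] at hz
    exact h0 (Multiset.prod_eq_zero hz)

/-- Up to sign, the constant term is the leading coefficient times the product of the roots; a small
value therefore forces a large total of `logSmall`. -/
theorem log_coeff_zero {f : K[X]} (hs : f.Splits) (h0 : f.coeff 0 ≠ 0) :
    Real.log (v (f.coeff 0)) = logMahler v f - (f.roots.map (logSmall v)).sum := by
  rw [coeff_zero_eq_eval_zero] at h0 ⊢
  rw [log_eval_eq hs h0, logMahler, add_sub_assoc, ← Multiset.sum_map_sub]
  congr 2
  refine Multiset.map_congr rfl fun z _ => ?_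
  rw [zero_sub, v.map_neg, logLarge_sub_logSmall]

theorem ne_zero_of_mem_roots {f : K[X]} (h0 : f.coeff 0 ≠ 0) {z : K} (hz : z ∈ f.roots) :
    z ≠ 0 := by
  rintro rfl
  exact h0 (by rw [coeff_zero_eq_eval_zero]; exact isRoot_of_mem_roots hz)

theorem log_eval_root_le (hv : IsNonarchimedean v) {f : K[X]} (hs : f.Splits)
    {y : K} (hy : f.eval y ≠ 0) :
    Real.log (v (f.eval y)) ≤ logMahler v f + f.natDegree * logLarge v y -
      (f.roots.map fun z => min (logSmall v y) (logSmall v z)).sum := by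
  rw [log_eval_eq hs hy, logMahler]
  have h : (f.roots.map fun z => Real.log (v (y - z))).sum ≤ (f.roots.map fun z =>
      logLarge v y + logLarge v z - min (logSmall v y) (logSmall v z)).sum := by
    refine Multiset.sum_map_le_sum_map _ _ fun z hz =>
      log_sub_le hv ?_
    rintro rfl
    exact hy (isRoot_of_mem_roots hz)
  refine (add_le_add_right h _).trans_eq ?_
  rw [Multiset.sum_map_sub, Multiset.sum_map_add, Multiset.map_const', Multiset.sum_replicate,
    ← hs.natDegree_eq_card_roots, nsmul_eq_mul]
  ring

/-- The resultant is a power of the leading coefficient of `f` times the product of the `g(y)` over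
the roots `y` of `f`. Together with a lower bound for the resultant, this limits how many roots of
`f` and `g` can be small simultaneously. -/
theorem log_resultant_le (hv : IsNonarchimedean v) {f g : K[X]} (hf : f.Splits) (hg : g.Splits)
    (hres : resultant f g ≠ 0) :
    Real.log (v (resultant f g)) ≤ g.natDegree * logMahler v f + f.natDegree * logMahler v g -
      (f.roots.map fun y =>
        (g.roots.map fun z => min (logSmall v y) (logSmall v z)).sum).sum := by
  rw [resultant_eq_prod_eval f g _ le_rfl hf] at hres ⊢
  have hp := right_ne_zero_of_mul hres
  have hl := left_ne_zero_of_mul hres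
  have hev : ∀ y ∈ f.roots, g.eval y ≠ 0 := fun y hy h =>
    hp (Multiset.prod_eq_zero (Multiset.mem_map.2 ⟨y, hy, h⟩))
  rw [v.map_mul, Real.log_mul (v.pos hl).ne' (v.pos hp).ne', v.map_pow, Real.log_pow,
    log_multiset_prod fun z hz h => hp (Multiset.prod_eq_zero (h ▸ hz)), Multiset.map_map]
  have h : (f.roots.map ((fun z => Real.log (v z)) ∘ fun y => g.eval y)).sum ≤ (f.roots.map fun y =>
      logMahler v g + g.natDegree * logLarge v y -
      (g.roots.map fun z => min (logSmall v y) (logSmall v z)).sum).sum :=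
    Multiset.sum_map_le_sum_map _ _ fun y hy =>
      log_eval_root_le hv hg (hev y hy)
  refine (add_le_add_right h _).trans_eq ?_
  rw [Multiset.sum_map_sub, Multiset.sum_map_add, Multiset.map_const', Multiset.sum_replicate,
    ← hf.natDegree_eq_card_roots, nsmul_eq_mul, Multiset.sum_map_mul_left]
  simp only [logMahler]
  ring

theorem gaussNorm_X_sub_C (z : K) : (X - C z).gaussNorm v 1 = max 1 (v z) := by
  apply le_antisymm
  · obtain ⟨i, hi⟩ := exists_eq_gaussNorm v 1 (X - C z)
    rw [hi, one_pow, mul_one]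
    rcases i with _ | _ | i
    · simp
    · simp [coeff_X]
    · simp [coeff_X]
  · have h1 := le_gaussNorm v (X - C z) zero_le_one 1
    have h0 := le_gaussNorm v (X - C z) zero_le_one 0
    have e1 : (X - C z).coeff 1 = (1 : K) := by simp [coeff_X]
    have e0 : (X - C z).coeff 0 = -z := by simp
    rw [e1, v.map_one] at h1
    rw [e0, v.map_neg] at h0
    exact max_le (by simpa using h1) (by simpa using h0)

/-- The Gauss norm is multiplicative, so linear factors suffice. This is how coefficient bounds
control `logMahler`. -/
theorem log_gaussNorm_eq (hv : IsNonarchimedean v) {f : K[X]} (hs : f.Splits) (hf0 : f ≠ 0) :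
    Real.log (f.gaussNorm v 1) = logMahler v f := by
  have h : ∀ s : Multiset K, 0 < (s.map fun z => X - C z).prod.gaussNorm v 1 ∧
      Real.log ((s.map fun z => X - C z).prod.gaussNorm v 1) = (s.map (logLarge v)).sum := by
    intro s
    induction s using Multiset.induction_on with
    | empty =>
      have : (1 : K[X]).gaussNorm v 1 = 1 := by
        rw [← C_1, gaussNorm_C]; simp
      simp [this]
    | cons a s ih =>
      have hpos : 0 < max 1 (v a) := lt_of_lt_of_le one_pos (le_max_left _ _)
      rw [Multiset.map_cons, Multiset.prod_cons, gaussNorm_mul hv one_pos, gaussNorm_X_sub_C,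
        Multiset.map_cons, Multiset.sum_cons, Real.log_mul hpos.ne' ih.1.ne', ih.2]
      refine ⟨mul_pos hpos ih.1, ?_⟩
      congr 1
      unfold logLarge
      rcases eq_or_ne a 0 with rfl | ha
      · simp
      rcases le_total 1 (v a) with h1 | h1
      · rw [max_eq_right h1, max_eq_right (Real.log_nonneg h1)]
      · rw [max_eq_left h1, max_eq_left (Real.log_nonpos (v.nonneg _) h1), Real.log_one]
  obtain ⟨h1, h2⟩ := h f.roots
  conv_lhs => rw [hs.eq_prod_roots]
  rw [gaussNorm_mul hv one_pos, gaussNorm_C, Real.log_mul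
    (v.pos (leadingCoeff_ne_zero.2 hf0)).ne' h1.ne', h2, logMahler]

/-- Of two polynomials with small constant terms and large resultant, the one with the smallest
root has a Newton polygon with a vertex at `1`. -/
theorem newtonSimple_of_resultant (hv : IsNonarchimedean v) {f g : K[X]} (hf : f.Splits)
    (hg0 : g.coeff 0 ≠ 0) (hg : g.Splits) (hf0 : f.coeff 0 ≠ 0) {n : ℕ} {h V : ℝ}
    (hfn : f.natDegree ≤ n) (hgn : g.natDegree ≤ n) (hfl : logMahler v f ≤ h)
    (hgl : logMahler v g ≤ h) (hfl0 : 0 ≤ logMahler v f) (hgl0 : 0 ≤ logMahler v g)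
    (hV : (n - 1) * h < V) (hVg : Real.log (v (g.coeff 0)) ≤ -V)
    (hres : (f.roots.map fun y => (g.roots.map fun z => min (logSmall v y) (logSmall v z)).sum).sum
      ≤ g.natDegree * logMahler v f + f.natDegree * logMahler v g)
    {z : K} (hz : z ∈ f.roots) (hzg : ∀ w ∈ g.roots, v z ≤ v w) :
    NewtonSimple v f ∧ v (f.coeff 0) = v z * v (f.coeff 1) := by
  obtain ⟨s, hs⟩ := Multiset.exists_cons_of_mem hz
  have hfz : f ≠ 0 := fun h => hf0 (by simp [h])
  by_cases hlt : ∀ w ∈ s, v z < v w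
  · have := newtonSimple_of_lt hv s hlt (leadingCoeff_ne_zero.2 hfz)
    rwa [← hs, ← hf.eq_prod_roots] at this
  · exfalso
    -- Let `w` be a second root with `|w| ≤ |z|`. Each of `z` and `w` contributes the full sum of
    -- `logSmall` over the roots of `g`, which is at least `logMahler v g + V`. So `2 V ≤ n h + (n -
    -- 2) h`, against `hV`; the degree is at least `2`, so the last term is legitimate.
    push Not at hlt
    obtain ⟨w, hw, hwz⟩ := hlt
    obtain ⟨t, ht⟩ := Multiset.exists_cons_of_mem hw
    have hd : (2 : ℝ) ≤ f.natDegree := by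
      have : f.natDegree = t.card + 2 := by
        rw [hf.natDegree_eq_card_roots, hs, ht]; simp
      rw [this]; push_cast; linarith [(t.card.cast_nonneg : (0 : ℝ) ≤ t.card)]
    have hmin : ∀ y, y ≠ 0 → v y ≤ v z →
        (g.roots.map fun z => min (logSmall v y) (logSmall v z)).sum =
        (g.roots.map (logSmall v)).sum := by
      intro y hy0 hyz
      congr 1
      refine Multiset.map_congr rfl fun w hw => min_eq_right ?_
      exact logSmall_anti hy0 (hyz.trans (hzg w hw))
    have hnn : 0 ≤ (t.map fun y =>
        (g.roots.map fun z => min (logSmall v y) (logSmall v z)).sum).sum := by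
      refine Multiset.sum_nonneg fun x hx => ?_
      obtain ⟨y, _, rfl⟩ := Multiset.mem_map.1 hx
      refine Multiset.sum_nonneg fun x hx => ?_
      obtain ⟨u, _, rfl⟩ := Multiset.mem_map.1 hx
      exact le_min (logSmall_nonneg _) (logSmall_nonneg _)
    have hw' : w ∈ f.roots := by rw [hs]; exact Multiset.mem_cons_of_mem hw
    rw [hs, ht] at hres
    simp only [Multiset.map_cons, Multiset.sum_cons] at hres
    rw [hmin z (ne_zero_of_mem_roots hf0 hz) le_rfl,
      hmin w (ne_zero_of_mem_roots hf0 hw') hwz] at hres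
    have hc := log_coeff_zero hg hg0 (v := v)
    have hfn' : (f.natDegree : ℝ) ≤ n := by exact_mod_cast hfn
    have hgn' : (g.natDegree : ℝ) ≤ n := by exact_mod_cast hgn
    have hn : (0 : ℝ) ≤ n := n.cast_nonneg
    have hh : 0 ≤ h := hfl0.trans hfl
    have e1 : (g.natDegree : ℝ) * logMahler v f ≤ n * h := by gcongr
    have e2 : ((f.natDegree : ℝ) - 2) * logMahler v g ≤ (n - 2) * h :=
      mul_le_mul (by linarith) hgl hgl0 (by linarith)
    nlinarith

/-- Termwise `a b = min a b * max a b`. It bounds the double sum of minima from below by the product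
of the two totals that the small values prescribe. -/
theorem sum_mul_sum_le {ι κ : Type*} (s : Multiset ι) (t : Multiset κ) (a : ι → ℝ) (b : κ → ℝ)
    {M : ℝ} (ha : ∀ i ∈ s, a i ≤ M) (hb : ∀ j ∈ t, b j ≤ M) (ha0 : ∀ i ∈ s, 0 ≤ a i)
    (hb0 : ∀ j ∈ t, 0 ≤ b j) :
    (s.map a).sum * (t.map b).sum ≤ M * (s.map fun i => (t.map fun j => min (a i) (b j)).sum).sum := by
  rw [← Multiset.sum_map_mul_right, ← Multiset.sum_map_mul_left]
  refine Multiset.sum_map_le_sum_map _ _ fun i hi => ?_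
  rw [← Multiset.sum_map_mul_left, ← Multiset.sum_map_mul_left]
  refine Multiset.sum_map_le_sum_map _ _ fun j hj => ?_
  rw [← min_mul_max (a i) (b j), mul_comm]
  exact mul_le_mul_of_nonneg_right (max_le (ha i hi) (hb j hj)) (le_min (ha0 i hi) (hb0 j hj))

end Resultant

/-! ### Heights and Taylor expansions over the polynomial ring -/

section Height

open Polynomial

variable {F : Type*} [Field F]

theorem order_incl {f : F[X]} (hf : f ≠ 0) : (incl F f).order = -(f.natDegree : ℤ) := by
  have h0 : (incl F f).coeff (-(f.natDegree : ℤ)) ≠ 0 := by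
    rw [coeff_incl]; exact leadingCoeff_ne_zero.2 hf
  refine le_antisymm (HahnSeries.order_le_of_coeff_ne_zero h0) ?_
  by_contra! hlt
  have h1 : (incl F f).order ≤ 0 := by omega
  obtain ⟨k, hk⟩ := Int.exists_eq_neg_ofNat h1
  have h2 : (incl F f).coeff (incl F f).order ≠ 0 := by
    rw [Ne, HahnSeries.coeff_order_eq_zero]
    exact (map_ne_zero_iff _ incl_injective).2 hf
  rw [hk, coeff_incl, coeff_eq_zero_of_natDegree_lt (by omega)] at h2
  exact h2 rfl

theorem absVal_incl {f : F[X]} (hf : f ≠ 0) :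
    absVal (incl F f) = (Nat.card F : ℝ) ^ f.natDegree := by
  rw [absVal, if_neg ((map_ne_zero_iff _ incl_injective).2 hf), order_incl hf]
  simp

theorem absVal_zero : absVal (0 : LaurentSeries F) = 0 := by simp [absVal]

/-- The Taylor expansion at `ξ` of a polynomial over `F[T]`. -/
def shift (ξ : LaurentSeries F) (P : F[X][X]) : (LaurentSeries F)[X] :=
  taylor ξ (P.map (incl F))

theorem exists_absVal_eq_height (P : F[X][X]) : ∃ i, height P = absVal (incl F (P.coeff i)) := by
  obtain ⟨i, _, h⟩ := Finset.exists_mem_eq_sup' (Finset.nonempty_range_add_one (n := P.natDegree))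
    fun i => absVal (incl F (P.coeff i))
  exact ⟨i, h⟩

theorem shift_coeff_zero (ξ : LaurentSeries F) (P : F[X][X]) :
    (shift ξ P).coeff 0 = evalAt P ξ := by
  rw [shift, taylor_coeff_zero, eval_map, evalAt]

theorem shift_natDegree (ξ : LaurentSeries F) (P : F[X][X]) :
    (shift ξ P).natDegree = P.natDegree := by
  rw [shift, natDegree_taylor, natDegree_map_eq_of_injective incl_injective]

theorem shift_eval (ξ : LaurentSeries F) (P : F[X][X]) (y : LaurentSeries F) :
    (shift ξ P).eval y = evalAt P (y + ξ) := by
  rw [shift, taylor_eval, eval_map, evalAt]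

theorem shift_add (ξ : LaurentSeries F) (P Q : F[X][X]) :
    shift ξ (P + Q) = shift ξ P + shift ξ Q := by
  simp [shift]

theorem shift_ne_zero (ξ : LaurentSeries F) {P : F[X][X]} (hP : P ≠ 0) : shift ξ P ≠ 0 := by
  rw [shift, Ne, taylor_eq_zero]
  exact (Polynomial.map_ne_zero_iff incl_injective).2 hP

/-- The constant by which Taylor expansion at `ξ` can increase the height. -/
def shiftConst (n : ℕ) (ξ : LaurentSeries F) : ℝ := max 1 (absVal ξ) ^ n

theorem one_le_shiftConst (n : ℕ) (ξ : LaurentSeries F) : 1 ≤ shiftConst n ξ :=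
  one_le_pow₀ (le_max_left _ _)

variable [Finite F]

theorem absVal_nonneg (ξ : LaurentSeries F) : 0 ≤ absVal ξ := (absAV F).nonneg ξ

theorem absVal_pos {ξ : LaurentSeries F} : 0 < absVal ξ ↔ ξ ≠ 0 := (absAV F).pos_iff

theorem absVal_mul (x y : LaurentSeries F) : absVal (x * y) = absVal x * absVal y :=
  (absAV F).map_mul x y

theorem absVal_pow (x : LaurentSeries F) (k : ℕ) : absVal (x ^ k) = absVal x ^ k :=
  (absAV F).map_pow x k

theorem one_le_absVal_incl {f : F[X]} (hf : f ≠ 0) : 1 ≤ absVal (incl F f) := by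
  rw [absVal_incl hf]; exact one_le_pow₀ one_lt_card.le

theorem absVal_le_height (P : F[X][X]) (i : ℕ) : absVal (incl F (P.coeff i)) ≤ height P := by
  rcases le_or_gt i P.natDegree with h | h
  · exact Finset.le_sup' (fun i => absVal (incl F (P.coeff i)))
      (Finset.mem_range.2 (Nat.lt_succ_of_le h))
  · rw [coeff_eq_zero_of_natDegree_lt h, map_zero, absVal_zero]
    exact (absVal_nonneg _).trans (Finset.le_sup' (fun i => absVal (incl F (P.coeff i)))
      (Finset.mem_range.2 (Nat.succ_pos _)))

theorem height_le_iff {P : F[X][X]} {B : ℝ} :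
    height P ≤ B ↔ ∀ i, absVal (incl F (P.coeff i)) ≤ B := by
  refine ⟨fun h i => (absVal_le_height P i).trans h, fun h => ?_⟩
  obtain ⟨i, hi⟩ := exists_absVal_eq_height P
  exact hi ▸ h i

theorem height_nonneg (P : F[X][X]) : 0 ≤ height P :=
  (absVal_nonneg _).trans (absVal_le_height P 0)

theorem one_le_height {P : F[X][X]} (hP : P ≠ 0) : 1 ≤ height P :=
  (one_le_absVal_incl (leadingCoeff_ne_zero.2 hP)).trans (absVal_le_height P _)

theorem height_pos {P : F[X][X]} (hP : P ≠ 0) : 0 < height P := one_pos.trans_le (one_le_height hP)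

theorem exists_height_eq_pow {P : F[X][X]} (hP : P ≠ 0) :
    ∃ k : ℕ, height P = (Nat.card F : ℝ) ^ k := by
  obtain ⟨i, hi⟩ := exists_absVal_eq_height P
  refine ⟨(P.coeff i).natDegree, ?_⟩
  rw [hi, absVal_incl]
  intro h
  rw [h, map_zero, absVal_zero] at hi
  exact (height_pos hP).ne' hi

/-- Gauss's lemma then makes the height multiplicative, so that divisors have no larger height. -/
theorem height_eq_gaussNorm (P : F[X][X]) :
    height P = (P.map (incl F)).gaussNorm (absAV F) 1 := by
  apply le_antisymm
  · rw [height_le_iff]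
    intro i
    simpa [absAV_apply] using le_gaussNorm (absAV F) (P.map (incl F)) zero_le_one i
  · obtain ⟨i, hi⟩ := exists_eq_gaussNorm (absAV F) 1 (P.map (incl F))
    rw [hi, one_pow, mul_one, coeff_map]
    exact absVal_le_height P i

theorem height_mul (P Q : F[X][X]) : height (P * Q) = height P * height Q := by
  simp only [height_eq_gaussNorm, Polynomial.map_mul]
  exact gaussNorm_mul isNonarchimedean_absAV one_pos _ _

theorem height_le_of_dvd {P Q : F[X][X]} (h : P ∣ Q) (hQ : Q ≠ 0) : height P ≤ height Q := by
  obtain ⟨R, rfl⟩ := h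
  rw [height_mul]
  exact le_mul_of_one_le_right (height_nonneg P) (one_le_height (right_ne_zero_of_mul hQ))

theorem height_add_le {P Q : F[X][X]} {B : ℝ} (hP : height P ≤ B) (hQ : height Q ≤ B) :
    height (P + Q) ≤ B := by
  rw [height_le_iff] at *
  intro i
  rw [coeff_add, map_add]
  exact add_le_of_le isNonarchimedean_absAV (hP i) (hQ i)

/-- Northcott finiteness: in bounded degree, infinitely many polynomials have unbounded height. -/
theorem finite_natDegree_le_height_le (n : ℕ) (B : ℝ) :
    {P : F[X][X] | P.natDegree ≤ n ∧ height P ≤ B}.Finite := by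
  obtain ⟨d, hd⟩ := pow_unbounded_of_one_lt B (one_lt_card (F := F))
  have hfin : Finite (degreeLT F d) := Finite.of_equiv _ (degreeLTEquiv F d).symm.toEquiv
  have key : ∀ P : F[X][X], height P ≤ B → ∀ i, P.coeff i ∈ degreeLT F d := by
    intro P hP i
    rcases eq_or_ne (P.coeff i) 0 with h | h
    · rw [h]; exact Submodule.zero_mem _
    · rw [mem_degreeLT, degree_eq_natDegree h]
      have h1 := (absVal_le_height P i).trans (hP.trans hd.le)
      have h2 : absVal (incl F (P.coeff i)) < (Nat.card F : ℝ) ^ d :=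
        (absVal_le_height P i).trans_lt (hP.trans_lt hd)
      rw [absVal_incl h] at h2
      exact_mod_cast (pow_lt_pow_iff_right₀ one_lt_card).1 h2
  let φ : {P : F[X][X] | P.natDegree ≤ n ∧ height P ≤ B} → (Fin (n + 1) → degreeLT F d) :=
    fun P i => ⟨(P : F[X][X]).coeff i, key P P.2.2 i⟩
  have : Function.Injective φ := by
    intro P Q h
    ext1
    ext1 i
    rcases le_or_gt i n with hi | hi
    · exact congrArg Subtype.val (congrFun h ⟨i, Nat.lt_succ_of_le hi⟩)
    · rw [coeff_eq_zero_of_natDegree_lt (P.2.1.trans_lt hi),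
        coeff_eq_zero_of_natDegree_lt (Q.2.1.trans_lt hi)]
  exact Finite.of_injective φ this

theorem absVal_natCast_le_one (k : ℕ) : absVal (k : LaurentSeries F) ≤ 1 :=
  isNonarchimedean_absAV.apply_natCast_le_one

theorem absVal_shift_coeff_le (ξ : LaurentSeries F) {P : F[X][X]} {n : ℕ} (hP : P.natDegree ≤ n)
    (k : ℕ) : absVal ((shift ξ P).coeff k) ≤ shiftConst n ξ * height P := by
  have hc : 0 ≤ shiftConst n ξ := zero_le_one.trans (one_le_shiftConst n ξ)
  rw [shift, taylor_coeff, eval_eq_sum]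
  refine sum_le_of_le isNonarchimedean_absAV _ _ (mul_nonneg hc (height_nonneg P)) fun i hi => ?_
  have hi' : i ≤ n := by
    refine (le_natDegree_of_mem_supp i hi).trans ((natDegree_hasseDeriv_le _ _).trans ?_)
    exact (Nat.sub_le _ _).trans (natDegree_map_le.trans hP)
  rw [hasseDeriv_coeff, coeff_map, absAV_apply, absVal_mul, absVal_mul, absVal_pow, mul_comm]
  have h1 : absVal ξ ^ i ≤ shiftConst n ξ :=
    (pow_le_pow_left₀ (absVal_nonneg _) (le_max_right _ _) i).trans
      (pow_le_pow_right₀ (le_max_left _ _) hi')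
  have h2 : absVal (((i + k).choose k : ℕ) : LaurentSeries F) * absVal (incl F (P.coeff (i + k))) ≤
      1 * height P := mul_le_mul (absVal_natCast_le_one _) (absVal_le_height _ _)
        (absVal_nonneg _) zero_le_one
  rw [one_mul] at h2
  exact mul_le_mul h1 h2 (mul_nonneg (absVal_nonneg _) (absVal_nonneg _)) hc

theorem absVal_evalAt_le (ξ : LaurentSeries F) {P : F[X][X]} {n : ℕ} (hP : P.natDegree ≤ n) :
    absVal (evalAt P ξ) ≤ shiftConst n ξ * height P := by
  rw [← shift_coeff_zero]; exact absVal_shift_coeff_le ξ hP 0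

/-- If `α` is a root of `P` then `|P(ξ)|` is controlled by `|ξ - α|`. -/
theorem absVal_evalAt_le_of_root {ξ α : LaurentSeries F} {P : F[X][X]} {n : ℕ}
    (hP : P.natDegree ≤ n) (hα : evalAt P α = 0) (h1 : absVal (ξ - α) ≤ 1) :
    absVal (evalAt P ξ) ≤ shiftConst n ξ * height P * absVal (ξ - α) := by
  have e : evalAt P ξ = -∑ k ∈ Finset.range (shift ξ P).natDegree,
      (shift ξ P).coeff (k + 1) * (α - ξ) ^ (k + 1) := by
    have h := shift_eval ξ P (α - ξ)
    rw [sub_add_cancel, hα, eval_eq_sum_range, Finset.sum_range_succ', shift_coeff_zero, pow_zero,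
      mul_one] at h
    linear_combination h
  have hc : 0 ≤ shiftConst n ξ := zero_le_one.trans (one_le_shiftConst n ξ)
  have hh := height_nonneg P
  have ha := absVal_nonneg (ξ - α)
  rw [e, ← absAV_apply, (absAV F).map_neg]
  refine sum_le_of_le isNonarchimedean_absAV _ _ (by positivity) fun k _ => ?_
  rw [absAV_apply, absVal_mul, absVal_pow, ← absAV_apply (α - ξ), (absAV F).map_sub, absAV_apply]
  refine mul_le_mul (absVal_shift_coeff_le ξ hP _) ?_ (by positivity) (by positivity)
  exact pow_le_of_le_one ha h1 (by omega)

end Height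

/-! ### Divisibility by minimal defining polynomials -/

section MinimalPolynomial

open Polynomial

variable {F : Type*} [Field F] {α : LaurentSeries F} {P : F[X][X]}

/-- Pseudo-division: cancelling leading terms shows, by induction on the degree, that `P` divides `c
Q` for some nonzero constant `c`. Since `P` is primitive, passing to primitive parts removes `c`. -/
theorem IsMinimalPolynomial.dvd_iff (hP : IsMinimalPolynomial α P) {Q : F[X][X]} :
    P ∣ Q ↔ evalAt Q α = 0 := by
  constructor
  · rintro ⟨R, rfl⟩
    rw [evalAt, eval₂_mul]
    exact mul_eq_zero_of_left hP.evalAt_eq_zero _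
  · intro hQ
    have key : ∀ m, ∀ Q : F[X][X], Q.natDegree ≤ m → evalAt Q α = 0 →
        ∃ c : F[X], c ≠ 0 ∧ P ∣ C c * Q := by
      intro m
      induction m with
      | zero =>
        intro Q hm hQ
        refine ⟨1, one_ne_zero, ?_⟩
        rw [eq_C_of_natDegree_le_zero hm, evalAt, eval₂_C, map_eq_zero_iff _ incl_injective] at hQ
        rw [eq_C_of_natDegree_le_zero hm, hQ]
        simp
      | succ m ih =>
        intro Q hm hQ
        rcases eq_or_ne Q 0 with rfl | hQ0
        · exact ⟨1, one_ne_zero, by simp⟩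
        have hd := hP.natDegree_le Q hQ0 hQ
        have hlP : P.leadingCoeff ≠ 0 := leadingCoeff_ne_zero.2 hP.isPrimitive.ne_zero
        obtain ⟨k, hk⟩ := Nat.exists_eq_add_of_le hd
        obtain ⟨c, hc, S, hS⟩ := ih
          (C P.leadingCoeff * Q - C Q.leadingCoeff * X ^ k * P) (by
            refine natDegree_le_iff_coeff_eq_zero.2 fun N hN => ?_
            have hNk : k ≤ N := by
              rcases lt_or_ge N k with h | h
              · omega
              · exact h
            obtain ⟨j, rfl⟩ := Nat.exists_eq_add_of_le' hNk
            rw [coeff_sub, coeff_C_mul, mul_assoc, coeff_C_mul, coeff_X_pow_mul]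
            rcases lt_or_ge P.natDegree j with h | h
            · rw [coeff_eq_zero_of_natDegree_lt h, coeff_eq_zero_of_natDegree_lt (by omega)]
              simp
            · have e1 : j = P.natDegree := by omega
              have e2 : j + k = Q.natDegree := by omega
              rw [e2, e1, coeff_natDegree, coeff_natDegree]
              ring) (by
            have e := hP.evalAt_eq_zero
            simp only [evalAt] at e hQ ⊢
            rw [eval₂_sub, eval₂_mul, eval₂_mul, hQ, e]
            simp)
        refine ⟨c * P.leadingCoeff, mul_ne_zero hc hlP, S + C c * (C Q.leadingCoeff * X ^ k), ?_⟩
        rw [C_mul]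
        linear_combination hS
    obtain ⟨c, hc, h⟩ := key _ Q le_rfl hQ
    rcases eq_or_ne Q 0 with rfl | hQ0
    · exact dvd_zero _
    let _ : NormalizedGCDMonoid F[X] := Classical.choice inferInstance
    have hne : C c * Q ≠ 0 := mul_ne_zero (C_ne_zero.2 hc) hQ0
    rw [← hP.isPrimitive.dvd_primPart_iff_dvd hne,
      (associated_primPart_mul hne).dvd_iff_dvd_right] at h
    rw [← hP.isPrimitive.dvd_primPart_iff_dvd hQ0]
    exact (isUnit_primPart_C c).dvd_mul_left.1 h

theorem IsMinimalPolynomial.prime (hP : IsMinimalPolynomial α P) : Prime P := by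
  refine ⟨hP.isPrimitive.ne_zero, fun h => ?_, fun A B h => ?_⟩
  · have h1 : evalAt 1 α = 0 := hP.dvd_iff.1 (isUnit_iff_dvd_one.1 h)
    simp [evalAt] at h1
  · rw [hP.dvd_iff, hP.dvd_iff, ← mul_eq_zero]
    rw [hP.dvd_iff, evalAt, eval₂_mul] at h
    exact h

theorem IsMinimalPolynomial.natDegree_pos (hP : IsMinimalPolynomial α P) : 0 < P.natDegree := by
  rcases Nat.eq_zero_or_pos P.natDegree with h | h
  · have h1 := hP.evalAt_eq_zero
    rw [eq_C_of_natDegree_eq_zero h, evalAt, eval₂_C, map_eq_zero_iff _ incl_injective] at h1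
    exact absurd (by rw [eq_C_of_natDegree_eq_zero h, h1, C_0]) hP.isPrimitive.ne_zero
  · exact h

theorem exists_isMinimalPolynomial_le [Finite F] {Q : F[X][X]} (hQ : Q ≠ 0)
    (h : evalAt Q α = 0) :
    ∃ P, IsMinimalPolynomial α P ∧ P.natDegree ≤ Q.natDegree ∧ height P ≤ height Q := by
  obtain ⟨P, hP⟩ := exists_isMinimalPolynomial ⟨Q, hQ, h⟩
  exact ⟨P, hP, hP.natDegree_le Q hQ h, height_le_of_dvd (hP.dvd_iff.2 h) hQ⟩

theorem finite_evalAt_eq_zero {Q : F[X][X]} (hQ : Q ≠ 0) :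
    {α : LaurentSeries F | evalAt Q α = 0}.Finite := by
  classical
  have h : Q.map (incl F) ≠ 0 := (Polynomial.map_ne_zero_iff incl_injective).2 hQ
  refine (Q.map (incl F)).roots.toFinset.finite_toSet.subset fun α hα => ?_
  simpa [h, evalAt, eval₂_eq_eval_map] using hα

end MinimalPolynomial

/-! ### Wirsing's argument for two coprime polynomials -/

section Wirsing

open Polynomial

/-- A bilinear function positive at the corners of a square is positive on the square. -/
theorem bilinear_pos {x y u V K : ℝ} (hx : 0 ≤ x) (hxu : x ≤ u) (hy : 0 ≤ y) (hyu : y ≤ u)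
    (hu : 0 < u) (hV : 0 < V) (h1 : K * u < (u + V) * V)
    (h2 : K * (u + u) < (u + V) * (u + V)) : K * (x + y) < (x + V) * (y + V) := by
  have hux : 0 ≤ u - x := sub_nonneg.2 hxu
  have huy : 0 ≤ u - y := sub_nonneg.2 hyu
  -- Interpolation from the four corners: the value at the origin is `V ^ 2`, and the two mixed
  -- corners share one value.
  have e : u ^ 2 * ((x + V) * (y + V) - K * (x + y)) = (u - x) * (u - y) * V ^ 2 +
      (x * (u - y) + (u - x) * y) * ((u + V) * V - K * u) +
      x * y * ((u + V) * (u + V) - K * (u + u)) := by ring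
  have h3 : 0 < (u + V) * V - K * u := sub_pos.2 h1
  have h4 : 0 < (u + V) * (u + V) - K * (u + u) := sub_pos.2 h2
  have hpos : 0 < (u - x) * (u - y) * V ^ 2 +
      (x * (u - y) + (u - x) * y) * ((u + V) * V - K * u) +
      x * y * ((u + V) * (u + V) - K * (u + u)) := by
    by_cases hz : (u - x) * (u - y) = 0
    · rw [hz, zero_mul, zero_add]
      by_cases hz' : x * (u - y) + (u - x) * y = 0
      · have : 0 < x * y := by nlinarith
        rw [hz', zero_mul, zero_add]; positivity
      · have : 0 < x * (u - y) + (u - x) * y := lt_of_le_of_ne (by positivity) (Ne.symm hz')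
        positivity
    · have : 0 < (u - x) * (u - y) := lt_of_le_of_ne (by positivity) (Ne.symm hz)
      positivity
  rw [← e] at hpos
  have := pos_of_mul_pos_right hpos (by positivity)
  linarith

theorem exists_min_root {L : Type*} [Field L] {v : AbsoluteValue L ℝ} {f : L[X]}
    (h : f.roots ≠ 0) : ∃ z ∈ f.roots, ∀ w ∈ f.roots, v z ≤ v w := by
  classical
  obtain ⟨z, hz, hmin⟩ := Finset.exists_min_image f.roots.toFinset v
    (by rwa [Multiset.toFinset_nonempty])
  exact ⟨z, Multiset.mem_toFinset.1 hz, fun w hw => hmin w (Multiset.mem_toFinset.2 hw)⟩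

/-- The smallest root of two polynomials with small constant terms and large resultant is small. -/
theorem log_smallest_root_le {L : Type*} [Field L] {v : AbsoluteValue L ℝ} {f g : L[X]}
    (hf : f.Splits) (hg : g.Splits) (hf0 : f.coeff 0 ≠ 0) (hg0 : g.coeff 0 ≠ 0)
    {n : ℕ} (hn : 1 ≤ n) {ℓ h : ℝ} (hℓ : 0 < ℓ) (hh : h ≤ (1 + 1 / (4 * (n + 1))) * ℓ)
    (hfn : f.natDegree ≤ n) (hgn : g.natDegree ≤ n) (hfl : logMahler v f ≤ h)
    (hgl : logMahler v g ≤ h) (hfl0 : 0 ≤ logMahler v f) (hgl0 : 0 ≤ logMahler v g)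
    (hVf : Real.log (v (f.coeff 0)) ≤ -((n - 1 / 4) * ℓ))
    (hVg : Real.log (v (g.coeff 0)) ≤ -((n - 1 / 4) * ℓ))
    (hres : (f.roots.map fun y => (g.roots.map fun z => min (logSmall v y) (logSmall v z)).sum).sum
      ≤ g.natDegree * logMahler v f + f.natDegree * logMahler v g)
    {z : L} (hz : z ∈ f.roots) (hzf : ∀ w ∈ f.roots, v z ≤ v w) (hzg : ∀ w ∈ g.roots, v z ≤ v w) :
    Real.log (v z) ≤ -((n + 1) / 2 * ℓ) := by
  have hz0 : z ≠ 0 := ne_zero_of_mem_roots hf0 hz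
  have hn1 : (1 : ℝ) ≤ n := by exact_mod_cast hn
  by_contra! hlt
  have hM : logSmall v z ≤ (n + 1) / 2 * ℓ := max_le (by positivity) (by linarith)
  have h1 := sum_mul_sum_le f.roots g.roots (logSmall v) (logSmall v)
    (fun w hw => (logSmall_anti hz0 (hzf w hw)).trans hM)
    (fun w hw => (logSmall_anti hz0 (hzg w hw)).trans hM)
    (fun w _ => logSmall_nonneg w) (fun w _ => logSmall_nonneg w)
  have ef := log_coeff_zero hf hf0 (v := v)
  have eg := log_coeff_zero hg hg0 (v := v)
  have hfn' : (f.natDegree : ℝ) ≤ n := by exact_mod_cast hfn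
  have hgn' : (g.natDegree : ℝ) ≤ n := by exact_mod_cast hgn
  set x := logMahler v f with hx
  set y := logMahler v g with hy
  have hV : 0 < ((n : ℝ) - 1 / 4) * ℓ := mul_pos (by linarith) hℓ
  have h2 : (g.natDegree : ℝ) * x + f.natDegree * y ≤ n * (x + y) := by nlinarith
  have h3 : (x + (n - 1 / 4) * ℓ) * (y + (n - 1 / 4) * ℓ) ≤
      (f.roots.map (logSmall v)).sum * (g.roots.map (logSmall v)).sum :=
    mul_le_mul (by linarith) (by linarith) (by linarith) (by linarith)
  -- If no root were small enough, the product of the two totals would be at most the largest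
  -- `logSmall` times the double sum, which the resultant bounds by `n (x + y)`. This fails at the
  -- corners of `[0, (1 + δ) ℓ]²`, hence on the whole square.
  have h4 : (x + (n - 1 / 4) * ℓ) * (y + (n - 1 / 4) * ℓ) ≤
      ((n + 1) / 2 * ℓ * n) * (x + y) := by
    refine h3.trans (h1.trans ?_)
    rw [mul_assoc _ (n : ℝ)]
    exact mul_le_mul_of_nonneg_left (hres.trans h2) (by positivity)
  set δ : ℝ := 1 / (4 * (n + 1)) with hδ
  have hδ0 : 0 < δ := by positivity
  have hδn : δ * (n + 1) = 1 / 4 := by rw [hδ]; field_simp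
  refine absurd h4 (not_le.2 (bilinear_pos (u := (1 + δ) * ℓ) hfl0 (hfl.trans hh) hgl0
    (hgl.trans hh) (by positivity) hV ?_ ?_))
  · have e : ((1 + δ) * ℓ + (n - 1 / 4) * ℓ) * ((n - 1 / 4) * ℓ) -
        (n + 1) / 2 * ℓ * n * ((1 + δ) * ℓ) = ℓ ^ 2 * (n ^ 2 / 2 - 3 / 16 + δ * (n - 1 / 4)
          - (δ * (n + 1)) * n / 2) := by ring
    rw [hδn] at e
    have : 0 < ℓ ^ 2 * (n ^ 2 / 2 - 3 / 16 + δ * (n - 1 / 4) - 1 / 4 * n / 2) := by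
      have : 0 < δ * ((n : ℝ) - 1 / 4) := mul_pos hδ0 (by linarith)
      have : 0 < (n : ℝ) ^ 2 / 2 - 3 / 16 + δ * (n - 1 / 4) - 1 / 4 * n / 2 := by nlinarith
      positivity
    linarith
  · have e : ((1 + δ) * ℓ + (n - 1 / 4) * ℓ) * ((1 + δ) * ℓ + (n - 1 / 4) * ℓ) -
        (n + 1) / 2 * ℓ * n * ((1 + δ) * ℓ + (1 + δ) * ℓ) = ℓ ^ 2 * (n / 2 + 9 / 16 + δ ^ 2 +
          2 * δ * (n + 3 / 4) - (δ * (n + 1)) * n) := by ring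
    rw [hδn] at e
    have : 0 < ℓ ^ 2 * (n / 2 + 9 / 16 + δ ^ 2 + 2 * δ * (n + 3 / 4) - 1 / 4 * n) := by
      have : 0 < (n : ℝ) / 2 + 9 / 16 + δ ^ 2 + 2 * δ * (n + 3 / 4) - 1 / 4 * n := by
        have : 0 < δ * ((n : ℝ) + 3 / 4) := by positivity
        nlinarith
      positivity
    linarith

variable {F : Type*} [Field F]

/-- Over the fraction field `P` remains irreducible by Gauss's lemma, so non-divisibility means
coprimality. -/
theorem resultant_ne_zero_of_prime {P Q : F[X][X]} (hP : Prime P) (hd : 0 < P.natDegree)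
    (h : ¬ P ∣ Q) : resultant P Q ≠ 0 := by
  let _ : NormalizedGCDMonoid F[X] := Classical.choice inferInstance
  have hprim : P.IsPrimitive := hP.irreducible.isPrimitive hd.ne'
  have hinj := IsFractionRing.injective F[X] (FractionRing F[X])
  have hirr : Irreducible (P.map (algebraMap F[X] (FractionRing F[X]))) :=
    hprim.irreducible_iff_irreducible_map_fraction_map.1 hP.irreducible
  intro h0
  have h1 : resultant (P.map (algebraMap F[X] (FractionRing F[X])))
      (Q.map (algebraMap F[X] (FractionRing F[X]))) = 0 := by
    rw [natDegree_map_eq_of_injective hinj, natDegree_map_eq_of_injective hinj,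
      resultant_map_map, h0, map_zero]
  rw [resultant_eq_zero_iff] at h1
  refine h1.2 (hirr.coprime_iff_not_dvd.2 fun hdvd => h ?_)
  exact hprim.dvd_of_fraction_map_dvd_fraction_map hdvd

/-- Translation preserves the leading coefficient, a nonzero polynomial in `T`, whence the lower
bound; the upper one is the Gauss norm of the Taylor coefficients. -/
theorem logMahler_shift_le [Finite F] {L : Type*} [Field L] [Algebra (LaurentSeries F) L]
    [IsAlgClosed L] {v : AbsoluteValue L ℝ} (hv : IsNonarchimedean v)
    (hext : ∀ x, v (algebraMap _ L x) = absAV F x) (ζ : LaurentSeries F) {P : F[X][X]} (hP : P ≠ 0)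
    {n : ℕ} (hn : P.natDegree ≤ n) {X : ℝ} (hX : height P ≤ X) :
    0 ≤ logMahler v ((shift ζ P).map (algebraMap _ L)) ∧
      logMahler v ((shift ζ P).map (algebraMap _ L)) ≤ Real.log (shiftConst n ζ) + Real.log X := by
  have hne : (shift ζ P).map (algebraMap _ L) ≠ 0 :=
    (Polynomial.map_ne_zero_iff (algebraMap (LaurentSeries F) L).injective).2 (shift_ne_zero ζ hP)
  have hXp : 0 < X := (height_pos hP).trans_le hX
  have hc : 0 < shiftConst n ζ := one_pos.trans_le (one_le_shiftConst n ζ)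
  constructor
  · refine add_nonneg (Real.log_nonneg ?_) (Multiset.sum_nonneg fun x hx => ?_)
    · rw [leadingCoeff_map, hext, shift, leadingCoeff_taylor,
        leadingCoeff_map_of_injective incl_injective]
      exact one_le_absVal_incl (leadingCoeff_ne_zero.2 hP)
    · obtain ⟨y, _, rfl⟩ := Multiset.mem_map.1 hx
      exact logLarge_nonneg y
  · rw [← log_gaussNorm_eq hv (IsAlgClosed.splits _) hne, ← Real.log_mul hc.ne' hXp.ne']
    obtain ⟨i, hi⟩ := exists_eq_gaussNorm v 1 ((shift ζ P).map (algebraMap _ L))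
    have hpos : 0 < ((shift ζ P).map (algebraMap _ L)).gaussNorm v 1 := by
      refine lt_of_le_of_ne (gaussNorm_nonneg v _ zero_le_one) (Ne.symm fun h => hne ?_)
      exact (gaussNorm_eq_zero_iff v _ (fun x hx => (AbsoluteValue.eq_zero v).mp hx) one_pos).1 h
    refine Real.log_le_log hpos ?_
    rw [hi, one_pow, mul_one, coeff_map, hext]
    exact (absVal_shift_coeff_le ζ hn i).trans (by gcongr)

/-- Wirsing's argument: of two coprime polynomials with small values at `ζ`, one has a closest root
in the field of power series. -/
theorem exists_newtonSimple_of_prime [Finite F] {n : ℕ} (hn : 1 ≤ n) (ζ : LaurentSeries F) :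
    ∃ B : ℝ, 1 < B ∧ ∀ X, B ≤ X → ∀ P Q : F[X][X], Prime P → 0 < P.natDegree → ¬ P ∣ Q →
      P.natDegree ≤ n → Q.natDegree ≤ n → height P ≤ X → height Q ≤ X → evalAt P ζ ≠ 0 →
      evalAt Q ζ ≠ 0 → absVal (evalAt P ζ) ≤ X ^ (-(n - 1 / 4) : ℝ) →
      absVal (evalAt Q ζ) ≤ X ^ (-(n - 1 / 4) : ℝ) →
      ∃ R : F[X][X], R.natDegree ≤ n ∧ height R ≤ X ∧ evalAt R ζ ≠ 0 ∧
        NewtonSimple (absAV F) (shift ζ R) ∧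
        (∀ α, evalAt P α = 0 → absVal (evalAt R ζ) ≤
          absVal (ζ - α) * absVal ((shift ζ R).coeff 1)) ∧
        absVal (evalAt R ζ) ≤ X ^ (-((n + 1) / 2) : ℝ) * absVal ((shift ζ R).coeff 1) := by
  obtain ⟨v, hv, hext, -⟩ := exists_absoluteValue_algebraicClosure F
  have hc := one_le_shiftConst n ζ
  have hlc := Real.log_nonneg hc
  have hn1 : (1 : ℝ) ≤ n := by exact_mod_cast hn
  -- The threshold makes `log (shiftConst n ζ)` at most `log X / (4 (n + 1))`, the slack available
  -- in `log_smallest_root_le`.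
  refine ⟨Real.exp (4 * (n + 1) * Real.log (shiftConst n ζ) + 1),
    by rw [Real.one_lt_exp_iff]; positivity, ?_⟩
  intro X hX P Q hP hPd hPQ hPn hQn hPX hQX hP0 hQ0 hPv hQv
  have hXp : 0 < X := (Real.exp_pos _).trans_le hX
  have hlX : 4 * (n + 1) * Real.log (shiftConst n ζ) + 1 ≤ Real.log X :=
    (Real.le_log_iff_exp_le hXp).2 hX
  have hℓ : 0 < Real.log X := lt_of_lt_of_le (by positivity) hlX
  have hh : Real.log (shiftConst n ζ) + Real.log X ≤ (1 + 1 / (4 * (n + 1))) * Real.log X := by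
    have : Real.log (shiftConst n ζ) ≤ 1 / (4 * (n + 1)) * Real.log X := by
      rw [one_div, inv_mul_eq_div, le_div_iff₀ (by positivity)]; linarith
    linarith
  have hQne : Q ≠ 0 := fun h => hPQ (h ▸ dvd_zero P)
  set φ := algebraMap (LaurentSeries F) (AlgebraicClosure (LaurentSeries F)) with hφ
  set f := (shift ζ P).map φ with hf
  set g := (shift ζ Q).map φ with hg
  have hfs : f.Splits := IsAlgClosed.splits _
  have hgs : g.Splits := IsAlgClosed.splits _
  have hfd : f.natDegree = P.natDegree := by rw [hf, natDegree_map, shift_natDegree]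
  have hgd : g.natDegree = Q.natDegree := by rw [hg, natDegree_map, shift_natDegree]
  have hcf : ∀ i, v (f.coeff i) = absVal ((shift ζ P).coeff i) := fun i => by
    rw [hf, coeff_map, hext, absAV_apply]
  have hcg : ∀ i, v (g.coeff i) = absVal ((shift ζ Q).coeff i) := fun i => by
    rw [hg, coeff_map, hext, absAV_apply]
  have hf0 : f.coeff 0 ≠ 0 := by
    rw [hf, coeff_map, shift_coeff_zero]; exact (map_ne_zero φ).2 hP0
  have hg0 : g.coeff 0 ≠ 0 := by
    rw [hg, coeff_map, shift_coeff_zero]; exact (map_ne_zero φ).2 hQ0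
  obtain ⟨hfl0, hfl⟩ := logMahler_shift_le hv hext ζ hP.ne_zero hPn hPX
  obtain ⟨hgl0, hgl⟩ := logMahler_shift_le hv hext ζ hQne hQn hQX
  have hval : ∀ {y : ℝ}, 0 < y → y ≤ X ^ (-(n - 1 / 4) : ℝ) →
      Real.log y ≤ -((n - 1 / 4) * Real.log X) := by
    intro y hy h
    refine (Real.log_le_log hy h).trans_eq ?_
    rw [Real.log_rpow hXp]; ring
  have hVf : Real.log (v (f.coeff 0)) ≤ -((n - 1 / 4) * Real.log X) := by
    rw [hcf, shift_coeff_zero]; exact hval (absVal_pos.2 hP0) hPv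
  have hVg : Real.log (v (g.coeff 0)) ≤ -((n - 1 / 4) * Real.log X) := by
    rw [hcg, shift_coeff_zero]; exact hval (absVal_pos.2 hQ0) hQv
  -- Translation does not change the resultant, so it comes from a polynomial in `T` and has
  -- absolute value at least `1` once it is nonzero.
  have hr : resultant f g = φ (incl F (resultant P Q)) := by
    rw [hfd, hgd, hf, hg, resultant_map_map]
    congr 1
    have := resultant_taylor (P.map (incl F)) (Q.map (incl F)) ζ
    rw [natDegree_taylor, natDegree_taylor, natDegree_map_eq_of_injective incl_injective,
      natDegree_map_eq_of_injective incl_injective, resultant_map_map] at this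
    exact this
  have hr0 := resultant_ne_zero_of_prime hP hPd hPQ
  have hr1 : resultant f g ≠ 0 := by
    rw [hr]; exact (map_ne_zero φ).2 ((map_ne_zero_iff _ incl_injective).2 hr0)
  have hrl : 0 ≤ Real.log (v (resultant f g)) := by
    rw [hr, hext]; exact Real.log_nonneg (one_le_absVal_incl hr0)
  have hres := log_resultant_le hv hfs hgs hr1
  have hres1 : (f.roots.map fun y =>
      (g.roots.map fun z => min (logSmall v y) (logSmall v z)).sum).sum
      ≤ g.natDegree * logMahler v f + f.natDegree * logMahler v g := by linarith
  have hres2 : (g.roots.map fun y =>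
      (f.roots.map fun z => min (logSmall v y) (logSmall v z)).sum).sum
      ≤ f.natDegree * logMahler v g + g.natDegree * logMahler v f := by
    rw [Multiset.sum_map_sum_map]
    simp only [min_comm] at hres1 ⊢
    linarith
  have hV : (n - 1) * (Real.log (shiftConst n ζ) + Real.log X) < (n - 1 / 4) * Real.log X := by
    have : (n - 1) * Real.log (shiftConst n ζ) ≤ 1 / 4 * Real.log X := by nlinarith
    nlinarith
  have hfn : f.natDegree ≤ n := hfd ▸ hPn
  have hgn : g.natDegree ≤ n := hgd ▸ hQn
  have hVpos : 0 < (n - 1 / 4) * Real.log X := mul_pos (by linarith) hℓ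
  have hfr : f.roots ≠ 0 := fun h => by
    have := log_coeff_zero hfs hf0 (v := v)
    rw [h, Multiset.map_zero, Multiset.sum_zero] at this
    linarith
  have hgr : g.roots ≠ 0 := fun h => by
    have := log_coeff_zero hgs hg0 (v := v)
    rw [h, Multiset.map_zero, Multiset.sum_zero] at this
    linarith
  obtain ⟨z, hz, hzmin⟩ := exists_min_root (v := v) hfr
  obtain ⟨w, hw, hwmin⟩ := exists_min_root (v := v) hgr
  have hroot : ∀ α, evalAt P α = 0 → φ (α - ζ) ∈ f.roots ∧ v (φ (α - ζ)) = absVal (ζ - α) := by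
    intro α hα
    refine ⟨(mem_roots fun h => hf0 (by simp [h])).2 ?_, ?_⟩
    · rw [IsRoot, hf, eval_map_apply, shift_eval, sub_add_cancel, hα, map_zero]
    · rw [hext, (absAV F).map_sub, absAV_apply]
  have hexp : ∀ {y : ℝ}, 0 < y → Real.log y ≤ -((n + 1) / 2 * Real.log X) →
      y ≤ X ^ (-((n + 1) / 2) : ℝ) := by
    intro y hy h
    rw [← Real.log_le_log_iff hy (by positivity), Real.log_rpow hXp]
    linarith
  -- `R` is whichever polynomial owns the smallest of all the roots; its smallest root is then no
  -- farther from `ζ` than any root of `P`.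
  rcases le_total (v z) (v w) with hle | hle
  · have hmin2 : ∀ u ∈ g.roots, v z ≤ v u := fun u hu => hle.trans (hwmin u hu)
    obtain ⟨h1, h2⟩ := newtonSimple_of_resultant hv hfs hg0 hgs hf0 hfn hgn hfl hgl hfl0 hgl0 hV
      hVg hres1 hz hmin2
    have h3 := log_smallest_root_le hfs hgs hf0 hg0 hn hℓ hh hfn hgn hfl hgl hfl0 hgl0 hVf hVg
      hres1 hz hzmin hmin2
    rw [hcf, hcf, shift_coeff_zero] at h2
    refine ⟨P, hPn, hPX, hP0, (newtonSimple_map φ hext).1 h1, fun α hα => ?_, ?_⟩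
    · rw [h2, ← (hroot α hα).2]
      exact mul_le_mul_of_nonneg_right (hzmin _ (hroot α hα).1) (absVal_nonneg _)
    · rw [h2]
      exact mul_le_mul_of_nonneg_right (hexp (v.pos (ne_zero_of_mem_roots hf0 hz)) h3)
        (absVal_nonneg _)
  · have hmin2 : ∀ u ∈ f.roots, v w ≤ v u := fun u hu => hle.trans (hzmin u hu)
    obtain ⟨h1, h2⟩ := newtonSimple_of_resultant hv hgs hf0 hfs hg0 hgn hfn hgl hfl hgl0 hfl0 hV
      hVf hres2 hw hmin2
    have h3 := log_smallest_root_le hgs hfs hg0 hf0 hn hℓ hh hgn hfn hgl hfl hgl0 hfl0 hVg hVf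
      hres2 hw hwmin hmin2
    rw [hcg, hcg, shift_coeff_zero] at h2
    refine ⟨Q, hQn, hQX, hQ0, (newtonSimple_map φ hext).1 h1, fun α hα => ?_, ?_⟩
    · rw [h2, ← (hroot α hα).2]
      exact mul_le_mul_of_nonneg_right (hmin2 _ (hroot α hα).1) (absVal_nonneg _)
    · rw [h2]
      exact mul_le_mul_of_nonneg_right (hexp (v.pos (ne_zero_of_mem_roots hg0 hw)) h3)
        (absVal_nonneg _)

end Wirsing

/-! ### Dirichlet's theorem and polynomials with a close root -/

section Dirichlet

open Polynomial

variable {F : Type*} [Field F] [Finite F]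

theorem absVal_le_zpow {ξ : LaurentSeries F} {d : ℤ} (h : ∀ i < d, ξ.coeff i = 0) :
    absVal ξ ≤ (Nat.card F : ℝ) ^ (-d) := by
  have hq := one_lt_card (F := F)
  rw [absVal]
  split_ifs with h0
  · positivity
  · refine zpow_le_zpow_right₀ hq.le (neg_le_neg ?_)
    by_contra! hlt
    exact h0 (HahnSeries.coeff_order_eq_zero.1 (h _ hlt))

theorem coeff_eq_zero_of_absVal_le {ξ : LaurentSeries F} {d : ℤ}
    (h : absVal ξ ≤ (Nat.card F : ℝ) ^ d) {i : ℤ} (hi : i < -d) : ξ.coeff i = 0 := by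
  rcases eq_or_ne ξ 0 with rfl | h0
  · simp
  · rw [absVal, if_neg h0, zpow_le_zpow_iff_right₀ one_lt_card] at h
    exact HahnSeries.coeff_eq_zero_of_lt_order (by omega)

theorem absVal_incl_le_of_natDegree_le {f : F[X]} {N : ℕ} (h : f.natDegree ≤ N) :
    absVal (incl F f) ≤ (Nat.card F : ℝ) ^ N := by
  rcases eq_or_ne f 0 with rfl | h0
  · rw [map_zero, absVal_zero]; positivity
  · rw [absVal_incl h0]; exact pow_le_pow_right₀ one_lt_card.le h

/-- Dirichlet's theorem: polynomials of bounded height with a small value at `ζ`. -/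
theorem exists_small_value (n : ℕ) (ζ : LaurentSeries F) :
    ∃ c : ℕ, ∀ N : ℕ, ∃ Q : F[X][X], Q ≠ 0 ∧ Q.natDegree ≤ n ∧
      height Q ≤ (Nat.card F : ℝ) ^ N ∧
      absVal (evalAt Q ζ) ≤ (Nat.card F : ℝ) ^ c * ((Nat.card F : ℝ) ^ N) ^ (-(n : ℝ)) := by
  have hq := one_lt_card (F := F)
  obtain ⟨c, hc⟩ := pow_unbounded_of_one_lt (shiftConst n ζ) hq
  refine ⟨c, fun N => ?_⟩
  have := Fintype.ofFinite F
  let p : (Fin (n + 1) → Fin (N + 1) → F) → F[X][X] := fun a =>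
    ∑ j : Fin (n + 1), monomial (j : ℕ) (∑ k : Fin (N + 1), monomial (k : ℕ) (a j k))
  have hpc : ∀ a (j : Fin (n + 1)),
      (p a).coeff j = ∑ k : Fin (N + 1), monomial (k : ℕ) (a j k) := by
    intro a j
    simp only [p, finsetSum_coeff, coeff_monomial, Fin.val_inj]
    simp
  have hpd : ∀ a, (p a).natDegree ≤ n := fun a =>
    natDegree_sum_le_of_forall_le _ _ fun j _ =>
      (natDegree_monomial_le _).trans (Nat.lt_succ_iff.1 j.2)
  have hph : ∀ a, height (p a) ≤ (Nat.card F : ℝ) ^ N := by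
    intro a
    rw [height_le_iff]
    intro i
    rcases lt_or_ge i (n + 1) with hi | hi
    · have := hpc a ⟨i, hi⟩
      simp only at this
      rw [this]
      exact absVal_incl_le_of_natDegree_le (natDegree_sum_le_of_forall_le _ _ fun k _ =>
        (natDegree_monomial_le _).trans (Nat.lt_succ_iff.1 k.2))
    · rw [coeff_eq_zero_of_natDegree_lt ((hpd a).trans_lt hi), map_zero, absVal_zero]
      positivity
  have hpinj : Function.Injective p := by
    intro a b h
    funext j k
    have h1 := congrArg (fun P : F[X][X] => (P.coeff j).coeff k) h
    simp only [hpc, finsetSum_coeff, coeff_monomial, Fin.val_inj] at h1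
    simpa using h1
  -- One condition fewer than the number of free coefficients, so the pigeonhole principle applies.
  -- The conditions start at index `-(N + c)`, since the height bound already kills the earlier
  -- coefficients.
  let m := (n + 1) * (N + 1) - 1
  have hm : m + 1 = (n + 1) * (N + 1) :=
    Nat.sub_add_cancel (Nat.mul_pos n.succ_pos N.succ_pos)
  let φ : (Fin (n + 1) → Fin (N + 1) → F) → (Fin m → F) := fun a i =>
    (evalAt (p a) ζ).coeff ((i : ℤ) - (N + c))
  obtain ⟨a, b, hab, hφ⟩ := Fintype.exists_ne_map_eq_of_card_lt φ (by
    simp only [Fintype.card_fun, Fintype.card_fin, ← pow_mul]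
    refine Nat.pow_lt_pow_right Fintype.one_lt_card ?_
    rw [mul_comm]; omega)
  have hd : (p a - p b).natDegree ≤ n := (natDegree_sub_le _ _).trans (max_le (hpd a) (hpd b))
  have hh : height (p a - p b) ≤ (Nat.card F : ℝ) ^ N := by
    rw [height_le_iff]
    intro i
    rw [coeff_sub, map_sub]
    exact sub_le_of_le isNonarchimedean_absAV (height_le_iff.1 (hph a) i)
      (height_le_iff.1 (hph b) i)
  refine ⟨p a - p b, sub_ne_zero.2 (hpinj.ne hab), hd, hh, ?_⟩
  have h1 : absVal (evalAt (p a - p b) ζ) ≤ (Nat.card F : ℝ) ^ ((N : ℤ) + c) := by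
    refine (absVal_evalAt_le ζ hd).trans ?_
    rw [zpow_add₀ (by positivity), mul_comm, zpow_natCast, zpow_natCast]
    exact mul_le_mul hh hc.le (zero_le_one.trans (one_le_shiftConst n ζ)) (by positivity)
  have h2 : absVal (evalAt (p a - p b) ζ) ≤ (Nat.card F : ℝ) ^ (-((m : ℤ) - (N + c))) := by
    refine absVal_le_zpow fun i hi => ?_
    rcases lt_or_ge i (-((N : ℤ) + c)) with hlt | hge
    · exact coeff_eq_zero_of_absVal_le h1 hlt
    · obtain ⟨k, hk⟩ := Int.eq_ofNat_of_zero_le (show 0 ≤ i + (N + c) by omega)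
      have h3 := congrFun hφ ⟨k, by omega⟩
      simp only [φ] at h3
      rw [show i = (k : ℤ) - (N + c) by omega, evalAt, eval₂_sub, HahnSeries.coeff_sub]
      exact sub_eq_zero.2 h3
  refine h2.trans ?_
  rw [← Real.rpow_natCast, ← Real.rpow_natCast, ← Real.rpow_mul (by positivity),
    ← Real.rpow_add (by positivity), ← Real.rpow_intCast]
  refine Real.rpow_le_rpow_of_exponent_le hq.le ?_
  have hm' : (m : ℝ) + 1 = (n + 1) * (N + 1) := by exact_mod_cast hm
  push_cast
  nlinarith [(n.cast_nonneg : (0 : ℝ) ≤ n)]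

theorem exists_pos_le_of_finite {ι : Type*} {s : Set ι} (hs : s.Finite) (f : ι → ℝ)
    (h : ∀ i ∈ s, 0 < f i) : ∃ κ, 0 < κ ∧ κ ≤ 1 ∧ ∀ i ∈ s, κ ≤ f i := by
  rcases s.eq_empty_or_nonempty with rfl | hne
  · exact ⟨1, one_pos, le_rfl, by simp⟩
  · obtain ⟨a, ha, hmin⟩ := Set.exists_min_image s f hs hne
    exact ⟨min 1 (f a), lt_min one_pos (h a ha), min_le_left _ _,
      fun i hi => (min_le_right _ _).trans (hmin i hi)⟩

/-- Irreducible polynomials of large height with a small value at `ζ`. -/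
theorem exists_prime_small_value {n : ℕ} (hn : 1 ≤ n) {ζ : LaurentSeries F}
    (hζ : ∀ Q : F[X][X], Q ≠ 0 → Q.natDegree ≤ n → evalAt Q ζ ≠ 0) (B : ℝ) :
    ∃ P : F[X][X], Prime P ∧ 0 < P.natDegree ∧ P.natDegree ≤ n ∧ B ≤ height P ∧
      absVal (evalAt P ζ) ≤ height P ^ (-(n - 1 / 4) : ℝ) := by
  by_contra! hcon
  have hq := one_lt_card (F := F)
  have hn1 : (1 : ℝ) ≤ n := by exact_mod_cast hn
  obtain ⟨κ, hκ, hκ1, hmin⟩ := exists_pos_le_of_finite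
    ((finite_natDegree_le_height_le (F := F) n B).subset (Set.sep_subset _ fun P => P ≠ 0))
    (fun P => absVal (evalAt P ζ)) (fun P hP => absVal_pos.2 (hζ P hP.2 hP.1.1))
  have hpow : ∀ P : F[X][X], P ≠ 0 → height P ^ (-(n - 1 / 4) : ℝ) ≤ 1 := fun P hP =>
    Real.rpow_le_one_of_one_le_of_nonpos (one_le_height hP) (by linarith)
  have hconst : ∀ P : F[X][X], P ≠ 0 → P.natDegree = 0 →
      κ ^ P.natDegree * height P ^ (-(n - 1 / 4) : ℝ) ≤ absVal (evalAt P ζ) := by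
    intro P hP hd
    rw [hd, pow_zero, one_mul]
    refine (hpow P hP).trans ?_
    rw [eq_C_of_natDegree_eq_zero hd, evalAt, eval₂_C]
    refine one_le_absVal_incl fun h => hP ?_
    rw [eq_C_of_natDegree_eq_zero hd, h, C_0]
  -- Heights and values are multiplicative, so the lower bound assumed for irreducible polynomials
  -- of large height spreads to products. Irreducible factors of small height cost at most `κ` each,
  -- which `κ ^ Q.natDegree` covers.
  have key : ∀ Q : F[X][X], Q ≠ 0 → Q.natDegree ≤ n →
      κ ^ Q.natDegree * height Q ^ (-(n - 1 / 4) : ℝ) ≤ absVal (evalAt Q ζ) := by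
    intro Q
    induction Q using UniqueFactorizationMonoid.induction_on_prime with
    | h₁ => exact fun h => absurd rfl h
    | h₂ x hx => exact fun h0 _ => hconst x h0 (natDegree_eq_zero_of_isUnit hx)
    | h₃ a p ha hp ih =>
      intro h0 hd
      rw [natDegree_mul hp.ne_zero ha] at hd ⊢
      have h1 := ih ha (by omega)
      have h2 : κ ^ p.natDegree * height p ^ (-(n - 1 / 4) : ℝ) ≤ absVal (evalAt p ζ) := by
        rcases Nat.eq_zero_or_pos p.natDegree with hz | hpos
        · exact hconst p hp.ne_zero hz
        · have hκp : κ ^ p.natDegree ≤ κ := pow_le_of_le_one hκ.le hκ1 hpos.ne'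
          rcases le_or_gt B (height p) with hB | hB
          · refine le_trans ?_ (hcon p hp hpos (by omega) hB).le
            exact mul_le_of_le_one_left (Real.rpow_nonneg (height_nonneg p) _)
              (hκp.trans hκ1)
          · refine le_trans ?_ (hmin p ⟨⟨by omega, hB.le⟩, hp.ne_zero⟩)
            exact (mul_le_of_le_one_right (by positivity) (hpow p hp.ne_zero)).trans hκp
      rw [evalAt, eval₂_mul, absVal_mul, height_mul,
        Real.mul_rpow (height_nonneg _) (height_nonneg _), pow_add, mul_mul_mul_comm]
      exact mul_le_mul h2 h1 (mul_nonneg (by positivity) (Real.rpow_nonneg (height_nonneg a) _))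
        (absVal_nonneg _)
  obtain ⟨c, hc⟩ := exists_small_value n ζ
  obtain ⟨M, hM⟩ := pow_unbounded_of_one_lt ((Nat.card F : ℝ) ^ c / κ ^ n) hq
  -- At height `Y = q ^ (4 M)`, Dirichlet's bound beats `key` by the factor `Y ^ (1/4) = q ^ M`,
  -- which exceeds the constants.
  obtain ⟨Q, hQ0, hQd, hQh, hQv⟩ := hc (4 * M)
  have h1 := (key Q hQ0 hQd).trans hQv
  set Y : ℝ := (Nat.card F : ℝ) ^ (4 * M) with hY
  have hYp : 0 < Y := by positivity
  have h2 : κ ^ n * Y ^ (-(n - 1 / 4) : ℝ) ≤ (Nat.card F : ℝ) ^ c * Y ^ (-(n : ℝ)) := by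
    refine le_trans ?_ h1
    exact mul_le_mul (pow_le_pow_of_le_one hκ.le hκ1 hQd)
      (Real.rpow_le_rpow_of_nonpos (height_pos hQ0) hQh (by linarith)) (by positivity)
      (by positivity)
  have h3 : Y ^ (-(n - 1 / 4) : ℝ) = Y ^ (-(n : ℝ)) * (Nat.card F : ℝ) ^ M := by
    rw [show (-(n - 1 / 4) : ℝ) = -(n : ℝ) + 1 / 4 by ring, Real.rpow_add hYp]
    congr 1
    rw [hY, ← Real.rpow_natCast, ← Real.rpow_natCast, ← Real.rpow_mul (by positivity)]
    congr 1
    push_cast; ring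
  rw [h3, mul_left_comm, mul_comm _ (Y ^ (-(n : ℝ)))] at h2
  have h4 := le_of_mul_le_mul_left h2 (by positivity)
  rw [div_lt_iff₀ (by positivity)] at hM
  linarith

/-- The polynomial in Wirsing's argument, for an irreducible polynomial with a small value. -/
theorem exists_newtonSimple {n : ℕ} (hn : 1 ≤ n) {ζ : LaurentSeries F}
    (hζ : ∀ Q : F[X][X], Q ≠ 0 → Q.natDegree ≤ n → evalAt Q ζ ≠ 0) :
    ∃ B : ℝ, 1 < B ∧ ∀ P : F[X][X], Prime P → 0 < P.natDegree → P.natDegree ≤ n → B ≤ height P →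
      absVal (evalAt P ζ) ≤ height P ^ (-(n - 1 / 4) : ℝ) →
      ∃ R : F[X][X], R.natDegree ≤ n ∧ height R ≤ height P ∧
        NewtonSimple (absAV F) (shift ζ R) ∧
        (∀ α, evalAt P α = 0 → absVal (evalAt R ζ) ≤
          absVal (ζ - α) * absVal ((shift ζ R).coeff 1)) ∧
        absVal (evalAt R ζ) ≤
          height P ^ (-((n + 1) / 2) : ℝ) * absVal ((shift ζ R).coeff 1) := by
  have hq := one_lt_card (F := F)
  obtain ⟨B, hB1, hB⟩ := exists_newtonSimple_of_prime hn ζ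
  obtain ⟨c, hc⟩ := exists_small_value n ζ
  refine ⟨max B ((Nat.card F : ℝ) ^ (4 * (c + n))), lt_max_of_lt_left hB1, ?_⟩
  intro P hP hPd hPn hPB hPv
  obtain ⟨k, hk⟩ := exists_height_eq_pow hP.ne_zero
  have hkc : 4 * (c + n) ≤ k := by
    have := (le_max_right _ _).trans hPB
    rwa [hk, pow_le_pow_iff_right₀ hq] at this
  obtain ⟨k, rfl⟩ := Nat.exists_eq_succ_of_ne_zero (show k ≠ 0 by omega)
  -- Here `H(P) = q ^ (k + 1)`: a polynomial of height at most `q ^ k` cannot be a multiple of `P`.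
  -- The threshold `4 (c + n)` pays for the constant `q ^ c` and for this lost power of `q`.
  obtain ⟨Q, hQ0, hQn, hQh, hQv⟩ := hc k
  have hQP : height Q < height P := by
    refine hQh.trans_lt ?_
    rw [hk]; exact pow_lt_pow_right₀ hq (Nat.lt_succ_self k)
  have hdvd : ¬ P ∣ Q := fun h => (height_le_of_dvd h hQ0).not_gt hQP
  obtain ⟨R, h1, h2, -, h3, h4, h5⟩ := hB (height P) ((le_max_left _ _).trans hPB) P Q hP hPd hdvd
    hPn hQn le_rfl hQP.le (hζ P hP.ne_zero hPn) (hζ Q hQ0 hQn) hPv (hQv.trans (by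
      rw [hk, ← Real.rpow_natCast, ← Real.rpow_natCast, ← Real.rpow_natCast,
        ← Real.rpow_mul (by positivity), ← Real.rpow_mul (by positivity),
        ← Real.rpow_add (by positivity)]
      refine Real.rpow_le_rpow_of_exponent_le hq.le ?_
      have : (4 : ℝ) * (c + n) ≤ k + 1 := by exact_mod_cast hkc
      push_cast
      nlinarith))
  exact ⟨R, h1, h2, h3, h4, h5⟩

/-- If the Newton polygon has no vertex at `1`, then the value at `ζ` is quadratically small in
terms of the distance to a root. -/
theorem absVal_evalAt_le_sq {ζ α : LaurentSeries F} {P : F[X][X]} {n : ℕ}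
    (hP : P.natDegree ≤ n) (hα : evalAt P α = 0) (h1 : absVal (ζ - α) ≤ 1)
    (hN : ¬ NewtonSimple (absAV F) (shift ζ P)) :
    absVal (evalAt P ζ) ≤ shiftConst n ζ * height P * absVal (ζ - α) ^ 2 := by
  have hc : 0 ≤ shiftConst n ζ := zero_le_one.trans (one_le_shiftConst n ζ)
  have hh := height_nonneg P
  set ε := absVal (ζ - α) with hε
  have hε0 : 0 ≤ ε := absVal_nonneg _
  by_contra! hlt
  have hε' : absAV F (α - ζ) = ε := by rw [(absAV F).map_sub]; rfl
  rw [← shift_coeff_zero] at hlt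
  -- Otherwise the constant term would strictly dominate the Taylor expansion at the root `α - ζ`.
  have hle : absAV F ((shift ζ P).coeff 0) ≤ absAV F ((shift ζ P).coeff 1) * ε := by
    by_contra! hlt1
    have h := shift_eval ζ P (α - ζ)
    rw [sub_add_cancel, hα, eval_eq_zero_add_one_add_sum] at h
    have hpos : 0 < absAV F ((shift ζ P).coeff 0) := lt_of_le_of_lt (by positivity) hlt
    have h2 := add_eq_left_of_lt isNonarchimedean_absAV
      (x := (shift ζ P).coeff 0) (y := (shift ζ P).coeff 1 * (α - ζ) +
        ∑ k ∈ Finset.range (shift ζ P).natDegree, (shift ζ P).coeff (k + 2) * (α - ζ) ^ (k + 2)) (by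
        refine (isNonarchimedean_absAV _ _).trans_lt (max_lt ?_
          (sum_lt_of_lt isNonarchimedean_absAV _ _ hpos fun k _ => lt_of_le_of_lt ?_ hlt))
        · rwa [(absAV F).map_mul, hε']
        · rw [(absAV F).map_mul, (absAV F).map_pow, hε']
          refine mul_le_mul (absVal_shift_coeff_le ζ hP _) ?_ (by positivity) (by positivity)
          exact pow_le_pow_of_le_one hε0 h1 (by omega))
    rw [h, (absAV F).map_zero] at h2
    exact hpos.ne h2
  refine hN ⟨fun h0 => ?_, fun k hk => ?_⟩
  · rw [h0, (absAV F).map_zero, zero_mul] at hle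
    exact absurd (hlt.trans_le hle) (not_lt.2 (by positivity))
  · by_contra! hge
    have hp : 0 < absAV F ((shift ζ P).coeff 1) := by
      refine (absAV F).pos fun h0 => ?_
      rw [h0, (absAV F).map_zero, zero_mul] at hle
      exact absurd (hlt.trans_le hle) (not_lt.2 (by positivity))
    obtain ⟨k, rfl⟩ := Nat.exists_eq_add_of_le' hk
    -- The failed vertex inequality together with `hle` bounds the linear coefficient by `shiftConst
    -- n ζ * height P * ε`; a second use of `hle` supplies the other factor `ε`.
    have h3 : absAV F ((shift ζ P).coeff 1) ^ (k + 2) ≤ (shiftConst n ζ * height P * ε) *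
        absAV F ((shift ζ P).coeff 1) ^ (k + 1) := by
      refine hge.trans ?_
      rw [show k + 2 - 1 = k + 1 by omega]
      calc absAV F ((shift ζ P).coeff (k + 2)) * absAV F ((shift ζ P).coeff 0) ^ (k + 1)
          ≤ (shiftConst n ζ * height P) * (absAV F ((shift ζ P).coeff 1) * ε) ^ (k + 1) := by
            refine mul_le_mul (absVal_shift_coeff_le ζ hP _)
              (pow_le_pow_left₀ ((absAV F).nonneg _) hle _) (by positivity) (by positivity)
        _ = (shiftConst n ζ * height P) * ε ^ (k + 1) *
            absAV F ((shift ζ P).coeff 1) ^ (k + 1) := by ring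
        _ ≤ _ := by
            gcongr
            exact pow_le_of_le_one hε0 h1 (by omega)
    rw [pow_succ' _ (k + 1)] at h3
    have h4 := le_of_mul_le_mul_right h3 (by positivity)
    have h5 : absAV F ((shift ζ P).coeff 0) ≤ shiftConst n ζ * height P * ε ^ 2 :=
      hle.trans ((mul_le_mul_of_nonneg_right h4 hε0).trans_eq (by ring))
    exact absurd hlt (not_lt.2 h5)

/-- Infinitely many algebraic approximations have unbounded height. -/
theorem exists_le_height_of_infinite {n : ℕ} {p : LaurentSeries F → F[X][X] → Prop}
    (h : {α : LaurentSeries F | ∃ P : F[X][X], IsMinimalPolynomial α P ∧ P.natDegree ≤ n ∧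
      p α P}.Infinite) (B : ℝ) :
    ∃ α P, IsMinimalPolynomial α P ∧ P.natDegree ≤ n ∧ p α P ∧ B < height P := by
  by_contra! hcon
  refine h (((finite_natDegree_le_height_le n B).subset
    (Set.sep_subset _ fun P => P ≠ 0)).biUnion (t := fun P => {α | evalAt P α = 0})
      (fun P hP => finite_evalAt_eq_zero hP.2) |>.subset ?_)
  rintro α ⟨P, hP, hd, hp⟩
  exact Set.mem_biUnion (x := P) ⟨⟨hd, hcon α P hP hd hp⟩, hP.isPrimitive.ne_zero⟩
    hP.evalAt_eq_zero

/-- Good approximation by algebraic elements yields good approximation by roots of polynomials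
whose Newton polygon has a vertex at `1`. -/
theorem exists_newtonSimple_of_infinite {n : ℕ} (hn : 1 ≤ n) {ζ : LaurentSeries F}
    (hζ : ∀ Q : F[X][X], Q ≠ 0 → Q.natDegree ≤ n → evalAt Q ζ ≠ 0) {w : ℝ} (hw : 0 < w)
    (h : {α : LaurentSeries F | ∃ P : F[X][X], IsMinimalPolynomial α P ∧ P.natDegree ≤ n ∧
      0 < absVal (ζ - α) ∧ absVal (ζ - α) < height P ^ (-w - 1)}.Infinite) (B : ℝ) :
    ∃ X, B ≤ X ∧ 1 < X ∧ ∃ R : F[X][X], R.natDegree ≤ n ∧ height R ≤ X ∧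
      NewtonSimple (absAV F) (shift ζ R) ∧
      absVal (evalAt R ζ) < X ^ (-w - 1) * absVal ((shift ζ R).coeff 1) := by
  have hc := one_le_shiftConst n ζ
  obtain ⟨B₁, hB₁, hR⟩ := exists_newtonSimple hn hζ
  -- Below `(n - 1) / 2` Wirsing's bound `X ^ (-(n + 1) / 2)` is already enough, without the given
  -- approximations.
  rcases lt_or_ge w ((n - 1) / 2) with hlt | hge
  · obtain ⟨P, hP, hPd, hPn, hPB, hPv⟩ := exists_prime_small_value hn hζ (max B B₁)
    have hX1 := hB₁.trans_le ((le_max_right _ _).trans hPB)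
    obtain ⟨R, h1, h2, h3, -, h5⟩ := hR P hP hPd hPn ((le_max_right _ _).trans hPB) hPv
    refine ⟨height P, (le_max_left _ _).trans hPB, hX1, R, h1, h2, h3, h5.trans_lt ?_⟩
    refine mul_lt_mul_of_pos_right ?_ h3.coeff_one_pos
    exact Real.rpow_lt_rpow_of_exponent_lt hX1 (by linarith)
  · obtain ⟨α, P, hP, hPn, ⟨hα0, hα⟩, hPB⟩ :=
      exists_le_height_of_infinite h (max (max B B₁) (shiftConst n ζ ^ 4))
    have hPB1 : B₁ < height P := (le_max_right _ _).trans_lt ((le_max_left _ _).trans_lt hPB)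
    have hPB2 : B < height P := (le_max_left _ _).trans_lt ((le_max_left _ _).trans_lt hPB)
    have hPB3 : shiftConst n ζ ^ 4 < height P := (le_max_right _ _).trans_lt hPB
    have hX1 := hB₁.trans hPB1
    have hα1 : absVal (ζ - α) ≤ 1 :=
      hα.le.trans (Real.rpow_le_one_of_one_le_of_nonpos hX1.le (by linarith))
    by_cases hN : NewtonSimple (absAV F) (shift ζ P)
    · refine ⟨height P, hPB2.le, hX1, P, hPn, le_rfl, hN, ?_⟩
      have h1 := hN.coeff_zero_le isNonarchimedean_absAV (y := α - ζ)
        (by rw [shift_eval, sub_add_cancel, hP.evalAt_eq_zero])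
      rw [(absAV F).map_sub, shift_coeff_zero, mul_comm] at h1
      exact h1.trans_lt (mul_lt_mul_of_pos_right hα hN.coeff_one_pos)
    -- The constant costs `H ^ (1/4)`, and `1/4 + 1 - 2 (w + 1) ≤ -(n - 1/4)` exactly because `w ≥
    -- (n - 1) / 2`.
    · have hv : absVal (evalAt P ζ) ≤ height P ^ (-(n - 1 / 4) : ℝ) := by
        refine (absVal_evalAt_le_sq hPn hP.evalAt_eq_zero hα1 hN).trans ?_
        have hX0 : 0 < height P := one_pos.trans hX1
        have e1 : shiftConst n ζ ≤ height P ^ (1 / 4 : ℝ) := by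
          have := Real.rpow_le_rpow (by positivity) hPB3.le (show (0 : ℝ) ≤ 1 / 4 by norm_num)
          rwa [← Real.rpow_natCast, ← Real.rpow_mul (by linarith), show ((4 : ℕ) : ℝ) * (1 / 4) = 1
            by norm_num, Real.rpow_one] at this
        have e2 : absVal (ζ - α) ^ 2 ≤ height P ^ ((-w - 1) * 2) := by
          rw [Real.rpow_mul hX0.le, ← Real.rpow_natCast (absVal (ζ - α))]
          exact Real.rpow_le_rpow hα0.le hα.le (by norm_num)
        calc shiftConst n ζ * height P * absVal (ζ - α) ^ 2
            ≤ height P ^ (1 / 4 : ℝ) * height P * height P ^ ((-w - 1) * 2) := by gcongr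
          _ = height P ^ (1 / 4 + 1 + (-w - 1) * 2) := by
              rw [Real.rpow_add hX0, Real.rpow_add hX0, Real.rpow_one]
          _ ≤ _ := Real.rpow_le_rpow_of_exponent_le hX1.le (by linarith)
      obtain ⟨R, h1, h2, h3, h4, -⟩ := hR P hP.prime hP.natDegree_pos hPn hPB1.le hv
      exact ⟨height P, hPB2.le, hX1, R, h1, h2, h3, (h4 α hP.evalAt_eq_zero).trans_lt
        (mul_lt_mul_of_pos_right hα h3.coeff_one_pos)⟩

end Dirichlet

/-! ### Decomposition over the `p`-th powers -/

section Frobenius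

open Polynomial

variable {F : Type*} [Field F]

theorem charP_laurentSeries (p : ℕ) [CharP F p] : CharP (LaurentSeries F) p :=
  charP_of_injective_ringHom (incl_injective (F := F)) p

theorem absVal_term [Finite F] {p : ℕ} (d : LaurentSeries F) (i : ℕ) :
    absVal (incl F X ^ i * d ^ p) = (Nat.card F : ℝ) ^ i * absVal d ^ p := by
  rw [absVal_mul, absVal_pow, absVal_pow, absVal_incl X_ne_zero, natDegree_X, pow_one]

section DistinctTerms

variable [Finite F] {p : ℕ} [Fact p.Prime]

/-- The exponents of `q` are congruent to `i` and to `j` modulo `p`. -/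
theorem absVal_term_ne {d e : LaurentSeries F} (hd : d ≠ 0) {i j : ℕ} (hi : i < p) (hj : j < p)
    (hij : i ≠ j) : absVal (incl F X ^ i * d ^ p) ≠ absVal (incl F X ^ j * e ^ p) := by
  have hq := one_lt_card (F := F)
  have hp : p ≠ 0 := (Fact.out : p.Prime).ne_zero
  rw [absVal_term, absVal_term]
  rcases eq_or_ne e 0 with rfl | he
  · rw [absVal_zero, zero_pow hp, mul_zero]
    have := absVal_pos.2 hd
    positivity
  · rw [absVal, if_neg hd, absVal, if_neg he]
    intro h
    rw [← zpow_natCast, ← zpow_natCast, ← zpow_natCast, ← zpow_natCast, ← zpow_mul, ← zpow_mul,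
      ← zpow_add₀ (by positivity), ← zpow_add₀ (by positivity)] at h
    have h1 := zpow_right_injective₀ (by positivity) hq.ne' h
    have h2 : ((i : ℤ) + -d.order * p) % p = ((j : ℤ) + -e.order * p) % p := by rw [h1]
    rw [Int.add_mul_emod_self_right, Int.add_mul_emod_self_right,
      Int.emod_eq_of_lt (by omega) (by omega), Int.emod_eq_of_lt (by omega) (by omega)] at h2
    omega

/-- The terms of a decomposition along `1, T, …, T ^ (p - 1)` have distinct absolute values. -/
theorem absVal_term_le_sum (d : ℕ → LaurentSeries F) {i : ℕ} (hi : i < p) :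
    (Nat.card F : ℝ) ^ i * absVal (d i) ^ p ≤
      absVal (∑ j ∈ Finset.range p, incl F X ^ j * d j ^ p) := by
  rw [← absVal_term]
  obtain ⟨m, hm, hmax⟩ := Finset.exists_max_image (Finset.range p)
    (fun j => absVal (incl F X ^ j * d j ^ p)) ⟨i, Finset.mem_range.2 hi⟩
  refine (hmax i (Finset.mem_range.2 hi)).trans ?_
  rcases eq_or_ne (incl F X ^ m * d m ^ p) 0 with h0 | h0
  · rw [h0, absVal_zero]; exact absVal_nonneg _
  have hd : d m ≠ 0 := fun h => h0 (by
    rw [h, zero_pow (Fact.out : p.Prime).ne_zero, mul_zero])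
  rw [← Finset.add_sum_erase _ _ hm]
  refine (add_eq_left_of_lt isNonarchimedean_absAV (sum_lt_of_lt isNonarchimedean_absAV _ _
    (absVal_pos.2 h0) fun j hj => ?_)).ge
  rw [Finset.mem_erase] at hj
  exact lt_of_le_of_ne (hmax j hj.2) (absVal_term_ne hd (Finset.mem_range.1 hm)
    (Finset.mem_range.1 hj.2) hj.1.symm).symm

theorem exists_absVal_sum_eq (d : ℕ → LaurentSeries F) :
    ∃ i < p, absVal (∑ j ∈ Finset.range p, incl F X ^ j * d j ^ p) =
      (Nat.card F : ℝ) ^ i * absVal (d i) ^ p := by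
  obtain ⟨m, hm, hmax⟩ := Finset.exists_max_image (Finset.range p)
    (fun j => absVal (incl F X ^ j * d j ^ p))
    ⟨0, Finset.mem_range.2 (Fact.out : p.Prime).pos⟩
  refine ⟨m, Finset.mem_range.1 hm, le_antisymm ?_ (absVal_term_le_sum d (Finset.mem_range.1 hm))⟩
  rw [← absVal_term]
  exact sum_le_of_le isNonarchimedean_absAV _ _ (absVal_nonneg _) hmax

end DistinctTerms

variable (p : ℕ) [Fact p.Prime] [CharP F p]

/-- A finite field is perfect, so coefficients are `p`-th powers; monomials are grouped by their
exponent modulo `p`. -/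
theorem exists_digits [Finite F] (f : F[X]) :
    ∃ g : ℕ → F[X], f = ∑ i ∈ Finset.range p, X ^ i * g i ^ p := by
  induction f using Polynomial.induction_on' with
  | add f g hf hg =>
    obtain ⟨a, ha⟩ := hf
    obtain ⟨b, hb⟩ := hg
    refine ⟨fun i => a i + b i, ?_⟩
    simp only [add_pow_char, mul_add, Finset.sum_add_distrib, ← ha, ← hb]
  | monomial n a =>
    obtain ⟨b, hb : b ^ p = a⟩ := (PerfectRing.bijective_frobenius (R := F) (p := p)).2 a
    have hp : 0 < p := (Fact.out : p.Prime).pos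
    refine ⟨fun i => if i = n % p then monomial (n / p) b else 0, ?_⟩
    rw [Finset.sum_eq_single (n % p)]
    · simp only [if_true]
      rw [monomial_pow, X_pow_mul_monomial, ← hb]
      rw [mul_comm, Nat.div_add_mod]
    · intro i _ hi
      simp only [if_neg hi]
      rw [zero_pow hp.ne', mul_zero]
    · intro h
      exact absurd (Finset.mem_range.2 (Nat.mod_lt n hp)) h

/-- Decomposition of a polynomial over `F[T]` along the basis `1, T, …, T ^ (p - 1)` over the
`p`-th powers. -/
theorem exists_frobenius_decomposition [Finite F] (P : F[X][X]) :
    ∃ Q : ℕ → F[X][X], (∀ i, (Q i).natDegree ≤ P.natDegree) ∧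
      P = ∑ i ∈ Finset.range p, C (X ^ i) * (Q i).map (frobenius F[X] p) := by
  choose g hg using fun k => exists_digits p (P.coeff k)
  refine ⟨fun i => ∑ k ∈ Finset.range (P.natDegree + 1), monomial k (g k i), fun i =>
    natDegree_sum_le_of_forall_le _ _ fun k hk => (natDegree_monomial_le _).trans
      (Nat.lt_succ_iff.1 (Finset.mem_range.1 hk)), ?_⟩
  ext1 k
  simp only [finsetSum_coeff, coeff_C_mul, coeff_map, coeff_monomial, Finset.sum_ite_eq',
    Finset.mem_range]
  split_ifs with h
  · simp only [frobenius_def]; exact hg k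
  · rw [coeff_eq_zero_of_natDegree_lt (by omega)]; simp

variable {p}

/-- Taylor expansion commutes with Frobenius, so one decomposition serves all Taylor coefficients at
once, including the value and the derivative. -/
theorem coeff_shift_pow {P : F[X][X]} {Q : ℕ → F[X][X]}
    (h : P = ∑ i ∈ Finset.range p, C (X ^ i) * (Q i).map (frobenius F[X] p))
    (ξ : LaurentSeries F) (k : ℕ) : (shift (ξ ^ p) P).coeff k =
      ∑ i ∈ Finset.range p, incl F X ^ i * (shift ξ (Q i)).coeff k ^ p := by
  have := charP_laurentSeries (F := F) p
  have hcomp : (incl F).comp (frobenius F[X] p) =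
      (frobenius (LaurentSeries F) p).comp (incl F) := by
    ext x <;> simp [frobenius_def]
  have hmap : P.map (incl F) = ∑ i ∈ Finset.range p, C (incl F X ^ i) *
      ((Q i).map (incl F)).map (frobenius (LaurentSeries F) p) := by
    rw [h, Polynomial.map_sum]
    refine Finset.sum_congr rfl fun i _ => ?_
    rw [Polynomial.map_mul, map_C, map_pow, map_map, map_map, hcomp]
  rw [shift, hmap, map_sum, finsetSum_coeff]
  refine Finset.sum_congr rfl fun i _ => ?_
  rw [taylor_mul, taylor_C, coeff_C_mul, ← frobenius_def p ξ, ← map_taylor, coeff_map, frobenius_def,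
    shift]

theorem coeff_incl_decomposition {P : F[X][X]} {Q : ℕ → F[X][X]}
    (h : P = ∑ i ∈ Finset.range p, C (X ^ i) * (Q i).map (frobenius F[X] p)) (k : ℕ) :
    incl F (P.coeff k) = ∑ i ∈ Finset.range p, incl F X ^ i * incl F ((Q i).coeff k) ^ p := by
  rw [h, finsetSum_coeff, map_sum]
  refine Finset.sum_congr rfl fun i _ => ?_
  rw [coeff_C_mul, coeff_map, frobenius_def, map_mul, map_pow, map_pow]

theorem exists_evalAt_ne_zero {P : F[X][X]} {Q : ℕ → F[X][X]}
    (h : P = ∑ i ∈ Finset.range p, C (X ^ i) * (Q i).map (frobenius F[X] p))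
    {ξ : LaurentSeries F} (h0 : evalAt P (ξ ^ p) ≠ 0) : ∃ i < p, evalAt (Q i) ξ ≠ 0 := by
  by_contra! hall
  refine h0 ?_
  rw [← shift_coeff_zero, coeff_shift_pow h]
  refine Finset.sum_eq_zero fun i hi => ?_
  rw [shift_coeff_zero, hall i (Finset.mem_range.1 hi), zero_pow (Fact.out : p.Prime).ne_zero,
    mul_zero]

variable [Finite F]

theorem height_pow_le {P : F[X][X]} {Q : ℕ → F[X][X]}
    (h : P = ∑ i ∈ Finset.range p, C (X ^ i) * (Q i).map (frobenius F[X] p)) {i : ℕ} (hi : i < p) :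
    height (Q i) ^ p ≤ height P := by
  obtain ⟨k, hk⟩ := exists_absVal_eq_height (Q i)
  rw [hk]
  refine le_trans ?_ (absVal_le_height P k)
  rw [coeff_incl_decomposition h]
  refine le_trans ?_ (absVal_term_le_sum _ hi)
  exact le_mul_of_one_le_left (pow_nonneg (absVal_nonneg _) _) (one_le_pow₀ one_lt_card.le)

theorem absVal_evalAt_pow_le {P : F[X][X]} {Q : ℕ → F[X][X]}
    (h : P = ∑ i ∈ Finset.range p, C (X ^ i) * (Q i).map (frobenius F[X] p))
    (ξ : LaurentSeries F) {i : ℕ} (hi : i < p) :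
    absVal (evalAt (Q i) ξ) ^ p ≤ absVal (evalAt P (ξ ^ p)) := by
  rw [← shift_coeff_zero, ← shift_coeff_zero, coeff_shift_pow h]
  refine le_trans ?_ (absVal_term_le_sum _ hi)
  exact le_mul_of_one_le_left (pow_nonneg (absVal_nonneg _) _) (one_le_pow₀ one_lt_card.le)

/-- Transfer of the Newton polygon from `ξ ^ p` to `ξ`. -/
theorem exists_newtonSimple_component {P : F[X][X]} {Q : ℕ → F[X][X]}
    (h : P = ∑ i ∈ Finset.range p, C (X ^ i) * (Q i).map (frobenius F[X] p))
    {ξ : LaurentSeries F} (hN : NewtonSimple (absAV F) (shift (ξ ^ p) P)) {c : ℝ}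
    (hc : absVal (evalAt P (ξ ^ p)) < c ^ p * absVal ((shift (ξ ^ p) P).coeff 1)) (hc0 : 0 ≤ c) :
    ∃ i < p, NewtonSimple (absAV F) (shift ξ (Q i)) ∧
      absVal (evalAt (Q i) ξ) < c * absVal ((shift ξ (Q i)).coeff 1) := by
  have hq := one_lt_card (F := F)
  have hp : p ≠ 0 := (Fact.out : p.Prime).ne_zero
  -- The component realising the size of the linear coefficient; for the other coefficients the
  -- inequality `hle` points the right way.
  obtain ⟨i, hi, h1⟩ := exists_absVal_sum_eq (p := p) fun j => (shift ξ (Q j)).coeff 1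
  rw [← coeff_shift_pow h] at h1
  have hle : ∀ k, (Nat.card F : ℝ) ^ i * absVal ((shift ξ (Q i)).coeff k) ^ p ≤
      absVal ((shift (ξ ^ p) P).coeff k) := fun k => by
    rw [coeff_shift_pow h]
    exact absVal_term_le_sum (fun j => (shift ξ (Q j)).coeff k) hi
  have hqi : 0 < (Nat.card F : ℝ) ^ i := by positivity
  refine ⟨i, hi, ⟨fun h0 => ?_, fun k hk => ?_⟩, ?_⟩
  · rw [h0, absVal_zero, zero_pow hp, mul_zero] at h1
    exact hN.coeff_one_pos.ne' h1
  · have h2 := hN.2 k hk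
    simp only [absAV_apply] at h2 ⊢
    rw [h1] at h2
    refine lt_of_pow_lt_pow_left₀ p (pow_nonneg (absVal_nonneg _) _) ?_
    -- Both sides of the vertex inequality are homogeneous of degree `k`, so the powers of `q ^ i`
    -- cancel.
    refine lt_of_mul_lt_mul_left (a := ((Nat.card F : ℝ) ^ i) ^ k) ?_ (by positivity)
    refine lt_of_le_of_lt ?_ (h2.trans_eq (by ring))
    obtain ⟨k, rfl⟩ := Nat.exists_eq_add_of_le' hk
    rw [show k + 2 - 1 = k + 1 by omega]
    calc _ = ((Nat.card F : ℝ) ^ i * absVal ((shift ξ (Q i)).coeff (k + 2)) ^ p) *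
          ((Nat.card F : ℝ) ^ i * absVal ((shift ξ (Q i)).coeff 0) ^ p) ^ (k + 1) := by ring
      _ ≤ _ := mul_le_mul (hle _) (pow_le_pow_left₀
          (mul_nonneg hqi.le (pow_nonneg (absVal_nonneg _) _)) (hle 0) _)
          (pow_nonneg (mul_nonneg hqi.le (pow_nonneg (absVal_nonneg _) _)) _) (absVal_nonneg _)
  · refine lt_of_pow_lt_pow_left₀ p (mul_nonneg hc0 (absVal_nonneg _)) ?_
    refine lt_of_mul_lt_mul_left (a := (Nat.card F : ℝ) ^ i) ?_ hqi.le
    rw [← shift_coeff_zero]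
    refine (hle 0).trans_lt ?_
    rw [shift_coeff_zero]
    refine hc.trans_eq ?_
    rw [h1]; ring

end Frobenius

/-! ### General properties of the two exponents -/

section Exponents

open Polynomial

variable {F : Type*} [Field F]

/-- Testing only `w` strictly below `a` leaves a power of the height to absorb constants. -/
theorem le_sSup_coe {S : Set ℝ} {a b : ℝ} (hba : b < a) (h : ∀ w, b < w → w < a → w ∈ S) :
    (a : EReal) ≤ sSup ((fun w : ℝ => (w : EReal)) '' S) := by
  by_contra! hlt
  obtain ⟨w, hw1, hw2⟩ := EReal.lt_iff_exists_real_btwn.1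
    (max_lt hlt (EReal.coe_lt_coe_iff.2 hba))
  have hS : w ∈ S := h w (EReal.coe_lt_coe_iff.1 ((le_max_right _ _).trans_lt hw1))
    (EReal.coe_lt_coe_iff.1 hw2)
  exact absurd ((le_max_left _ _).trans_lt hw1) (not_lt.2 (le_sSup ⟨w, hS, rfl⟩))

theorem sSup_coe_le {S : Set ℝ} {b : EReal} (hb : 0 ≤ b) (h : ∀ w ∈ S, 0 < w → (w : EReal) ≤ b) :
    sSup ((fun w : ℝ => (w : EReal)) '' S) ≤ b := by
  refine sSup_le ?_
  rintro _ ⟨w, hw, rfl⟩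
  rcases le_or_gt w 0 with h0 | h0
  · exact (EReal.coe_le_coe_iff.2 h0).trans hb
  · exact h w hw h0

theorem evalAt_linear (a b : F[X]) (ξ : LaurentSeries F) :
    evalAt (C a * X - C b) ξ = incl F a * ξ - incl F b := by
  simp [evalAt]

theorem absVal_incl_X_pow (N : ℕ) : absVal (incl F (X ^ N)) = (Nat.card F : ℝ) ^ N := by
  rw [absVal_incl (pow_ne_zero _ X_ne_zero), natDegree_X_pow]

theorem coeff_one_linear (a b : F[X]) : (C a * X - C b : F[X][X]).coeff 1 = a := by
  rw [coeff_sub, coeff_C_mul, coeff_X_one, coeff_C_of_ne_zero one_ne_zero, mul_one, sub_zero]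

theorem natDegree_linear_sub_le (a b : F[X]) : (C a * X - C b : F[X][X]).natDegree ≤ 1 := by
  rw [sub_eq_add_neg, ← C_neg]
  exact natDegree_linear_le

theorem infinite_of_exists_le_height {S : Set F[X][X]} (h : ∀ B, ∃ P ∈ S, B < height P) :
    S.Infinite := by
  intro hS
  obtain ⟨B, hB⟩ := (hS.image height).bddAbove
  obtain ⟨P, hP, hlt⟩ := h B
  exact absurd (hB ⟨P, hP, rfl⟩) (not_le.2 hlt)

theorem IsMinimalPolynomial.ne_zero {ξ : LaurentSeries F} {P : F[X][X]}
    (hP : IsMinimalPolynomial ξ P) : P ≠ 0 := hP.isPrimitive.ne_zero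

variable [Finite F]

theorem exists_integral_part (η : LaurentSeries F) :
    ∃ b : F[X], 0 < absVal (η - incl F b) ∧ absVal (η - incl F b) ≤ 1 := by
  have hq := one_lt_card (F := F)
  obtain ⟨k, hk⟩ : ∃ k : ℕ, -η.order < k := ⟨(-η.order).toNat + 1, by omega⟩
  set b : F[X] := ∑ i ∈ Finset.range k, monomial i (η.coeff (-(i : ℤ))) with hb
  have hlt : absVal (η - incl F b) < 1 := by
    refine (absVal_le_zpow (d := 1) fun i hi => ?_).trans_lt
      (zpow_lt_one_of_neg₀ hq (by norm_num))
    obtain ⟨j, rfl⟩ := Int.exists_eq_neg_ofNat (show i ≤ 0 by omega)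
    rw [HahnSeries.coeff_sub, coeff_incl, hb, finsetSum_coeff]
    simp only [coeff_monomial, Finset.sum_ite_eq', Finset.mem_range]
    split_ifs with h
    · exact sub_self _
    · rw [sub_zero]
      exact HahnSeries.coeff_eq_zero_of_lt_order (by omega)
  rcases eq_or_ne (η - incl F b) 0 with h0 | h0
  -- When `η` is itself a polynomial, moving by `1` keeps the difference nonzero.
  · refine ⟨b - 1, ?_⟩
    have h1 : absVal (1 : LaurentSeries F) = 1 := (absAV F).map_one
    rw [map_sub, map_one, ← sub_add, h0, zero_add, h1]
    exact ⟨one_pos, le_rfl⟩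
  · exact ⟨b, absVal_pos.2 h0, hlt.le⟩

theorem exists_linear_small_value (ξ : LaurentSeries F) (N : ℕ) : ∃ b : F[X],
    0 < absVal (incl F (X ^ N) * ξ - incl F b) ∧ absVal (incl F (X ^ N) * ξ - incl F b) ≤ 1 :=
  exists_integral_part _

/-- The polynomials `T^N X - b`, with `b` close to `T^N ξ`, take nonzero values of size at most `1`,
enough for every negative exponent. -/
theorem zero_le_wExp {n : ℕ} (hn : 1 ≤ n) (ξ : LaurentSeries F) : 0 ≤ wExp n ξ := by
  have hq := one_lt_card (F := F)
  refine le_sSup_coe (a := 0) (b := -1) (by norm_num) fun w _ hw => ?_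
  choose b hb0 hb1 using exists_linear_small_value ξ
  refine Set.infinite_of_injective_forall_mem
    (f := fun N : ℕ => C (X ^ (N + 1)) * X - C (b (N + 1))) (fun M N h => ?_) fun N => ⟨?_, ?_, ?_⟩
  · have h1 := congrArg (fun P : F[X][X] => (P.coeff 1).natDegree) h
    simpa only [coeff_one_linear, natDegree_X_pow, add_left_inj] using h1
  · exact (natDegree_linear_sub_le _ _).trans hn
  · rw [evalAt_linear]; exact hb0 _
  · rw [evalAt_linear]
    refine (hb1 _).trans_lt (Real.one_lt_rpow (lt_of_lt_of_le ?_ (absVal_le_height _ 1))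
      (by linarith))
    rw [coeff_one_linear, absVal_incl_X_pow]
    exact one_lt_pow₀ hq (by omega)

/-- A criterion for `w` to be smaller than `wStarExp n ξ`. -/
theorem infinite_algebraic_approximations {n : ℕ} {ξ : LaurentSeries F} {w : ℝ} (hw : -1 < w)
    (h : ∀ B : ℝ, ∃ Y, B ≤ Y ∧ ∃ α, ∃ Q : F[X][X], Q ≠ 0 ∧ Q.natDegree ≤ n ∧ evalAt Q α = 0 ∧
      height Q ≤ Y ∧ 0 < absVal (ξ - α) ∧ absVal (ξ - α) < Y ^ (-w - 1)) :
    {α : LaurentSeries F | ∃ P : F[X][X], IsMinimalPolynomial α P ∧ P.natDegree ≤ n ∧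
      0 < absVal (ξ - α) ∧ absVal (ξ - α) < height P ^ (-w - 1)}.Infinite := by
  intro hfin
  obtain ⟨κ, hκ, -, hmin⟩ := exists_pos_le_of_finite hfin (fun α => absVal (ξ - α))
    (fun α ⟨P, _, _, h0, _⟩ => h0)
  -- For `Y` beyond this bound, `Y ^ (-w - 1) ≤ κ`, so the new `α` is closer than the closest of the
  -- finitely many.
  obtain ⟨Y, hY, α, Q, hQ0, hQn, hQα, hQY, hα0, hα⟩ := h (κ ^ (-(w + 1)⁻¹))
  obtain ⟨P, hP, hPd, hPh⟩ := exists_isMinimalPolynomial_le hQ0 hQα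
  have hmem := hmin α ⟨P, hP, hPd.trans hQn, hα0, hα.trans_le
    (Real.rpow_le_rpow_of_nonpos (height_pos hP.isPrimitive.ne_zero) (hPh.trans hQY)
      (by linarith))⟩
  have h1 : Y ^ (-w - 1) ≤ (κ ^ (-(w + 1)⁻¹)) ^ (-w - 1) :=
    Real.rpow_le_rpow_of_nonpos (by positivity) hY (by linarith)
  rw [← Real.rpow_mul hκ.le, show -(w + 1)⁻¹ * (-w - 1) = (w + 1)⁻¹ * (w + 1) by ring,
    inv_mul_cancel₀ (by linarith), Real.rpow_one] at h1
  exact absurd (hα.trans_le h1) (not_lt.2 hmem)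

theorem exists_rpow_ge {s : ℝ} (hs : 0 < s) (c : ℝ) : ∃ B : ℝ, 1 ≤ B ∧ ∀ x, B ≤ x → c < x ^ s := by
  have h := (tendsto_rpow_atTop hs).eventually_gt_atTop c
  obtain ⟨B, hB⟩ := Filter.eventually_atTop.1 h
  exact ⟨max 1 B, le_max_left _ _, fun x hx => hB x ((le_max_right _ _).trans hx)⟩

/-- The fractions `b / T^N` lie within `q ^ (-N)` of `ξ` and have height at most `max 1 |ξ| * q ^
N`. -/
theorem zero_le_wStarExp {n : ℕ} (hn : 1 ≤ n) (ξ : LaurentSeries F) : 0 ≤ wStarExp n ξ := by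
  have hq := one_lt_card (F := F)
  refine le_sSup_coe (a := 0) (b := -1) (by norm_num) fun w hw1 hw => ?_
  refine infinite_algebraic_approximations hw1 fun B => ?_
  set c : ℝ := max 1 (absVal ξ) with hc
  have hc1 : 1 ≤ c := le_max_left _ _
  obtain ⟨B', hB'1, hB'⟩ := exists_rpow_ge (neg_pos.2 hw) c
  obtain ⟨N, hN⟩ := pow_unbounded_of_one_lt (max B B') hq
  obtain ⟨b, hb0, hb1⟩ := exists_linear_small_value ξ N
  set t : ℝ := (Nat.card F : ℝ) ^ N with ht
  have ht0 : 0 < t := by positivity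
  have ht1 : 1 ≤ t := one_le_pow₀ hq.le
  have htc : t ≤ c * t := le_mul_of_one_le_left ht0.le hc1
  have hT : incl F (X ^ N) ≠ 0 :=
    (map_ne_zero_iff _ incl_injective).2 (pow_ne_zero _ X_ne_zero)
  have hdiff : incl F (X ^ N) * (ξ - incl F b / incl F (X ^ N)) =
      incl F (X ^ N) * ξ - incl F b := by field_simp
  have habs : t * absVal (ξ - incl F b / incl F (X ^ N)) =
      absVal (incl F (X ^ N) * ξ - incl F b) := by
    rw [← hdiff, absVal_mul, absVal_incl_X_pow]
  refine ⟨c * t, (le_max_left _ _).trans (hN.le.trans htc), incl F b / incl F (X ^ N),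
    C (X ^ N) * X - C b, fun h => ?_, ?_, ?_, ?_, ?_, ?_⟩
  · have h1 := congrArg (fun P : F[X][X] => P.coeff 1) h
    simp only [coeff_one_linear, coeff_zero] at h1
    exact pow_ne_zero N X_ne_zero h1
  · exact (natDegree_linear_sub_le _ _).trans hn
  · rw [evalAt_linear, mul_div_cancel₀ _ hT, sub_self]
  · have hbt : absVal (incl F b) ≤ c * t := by
      have : incl F b = incl F (X ^ N) * ξ - (incl F (X ^ N) * ξ - incl F b) := by ring
      rw [this]
      refine sub_le_of_le isNonarchimedean_absAV ?_ (hb1.trans (ht1.trans htc))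
      rw [absAV_apply, absVal_mul, absVal_incl_X_pow, mul_comm]
      exact mul_le_mul_of_nonneg_right (le_max_right _ _) ht0.le
    rw [height_le_iff]
    rintro (_ | _ | i)
    · simpa [← absAV_apply] using hbt
    · rw [zero_add, coeff_one_linear, absVal_incl_X_pow]
      exact htc
    · simp only [coeff_sub, coeff_C_mul, coeff_X, coeff_C]
      simp only [absVal_zero, map_zero, sub_zero, mul_zero, Nat.add_eq_zero_iff, one_ne_zero,
        and_false, if_false, show ¬ (1 = i + 1 + 1) by omega]
      positivity
  · rw [← habs] at hb0
    exact pos_of_mul_pos_right hb0 ht0.le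
  · have h1 : absVal (ξ - incl F b / incl F (X ^ N)) ≤ t⁻¹ := by
      rw [← habs] at hb1
      rwa [← one_div, le_div_iff₀' ht0]
    refine h1.trans_lt ?_
    have hct : 0 < c * t := by positivity
    rw [Real.rpow_sub_one hct.ne', lt_div_iff₀ hct, mul_comm, mul_assoc, mul_inv_cancel₀ ht0.ne',
      mul_one]
    exact hB' _ ((le_max_right _ _).trans (hN.le.trans htc))

theorem exists_le_height_of_infinite' {n : ℕ} {S : Set F[X][X]} (hS : S.Infinite)
    (hn : ∀ P ∈ S, P.natDegree ≤ n) (B : ℝ) : ∃ P ∈ S, B < height P := by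
  by_contra! h
  exact hS ((finite_natDegree_le_height_le n B).subset fun P hP => ⟨hn P hP, h P hP⟩)

/-- The two exponents satisfy `w_n^* ≤ w_n`. -/
theorem wStarExp_le_wExp {n : ℕ} (hn : 1 ≤ n) (ξ : LaurentSeries F) : wStarExp n ξ ≤ wExp n ξ := by
  refine sSup_coe_le (zero_le_wExp hn ξ) fun w hw hw0 => le_sSup_coe hw0 fun w' hw'0 hw' => ?_
  -- Ensures `P(ξ) ≠ 0` at large height: a prime `P` vanishing at `ξ` is associated to the minimal
  -- polynomial of `ξ`.
  have hroot : ∃ B₀ : ℝ, ∀ P : F[X][X], Prime P → evalAt P ξ = 0 → height P ≤ B₀ := by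
    by_cases halg : ∃ Q : F[X][X], Q ≠ 0 ∧ evalAt Q ξ = 0
    · obtain ⟨Z, hZ⟩ := exists_isMinimalPolynomial halg
      refine ⟨height Z, fun P hP h0 => height_le_of_dvd ?_ hZ.isPrimitive.ne_zero⟩
      exact (hZ.prime.dvd_prime_iff_associated hP).1 (hZ.dvd_iff.2 h0) |>.symm.dvd
    · exact ⟨0, fun P hP h0 => absurd ⟨P, hP.ne_zero, h0⟩ halg⟩
  obtain ⟨B₀, hB₀⟩ := hroot
  obtain ⟨B₁, hB₁1, hB₁⟩ := exists_rpow_ge (sub_pos.2 hw') (shiftConst n ξ)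
  refine infinite_of_exists_le_height fun B => ?_
  obtain ⟨α, P, hP, hPn, ⟨hα0, hα⟩, hPB⟩ :=
    exists_le_height_of_infinite hw (max B (max B₀ B₁))
  have hPB1 : B₁ < height P := (le_max_right _ _).trans_lt ((le_max_right _ _).trans_lt hPB)
  have hPB0 : B₀ < height P := (le_max_left _ _).trans_lt ((le_max_right _ _).trans_lt hPB)
  have hX1 : 1 < height P := hB₁1.trans_lt hPB1
  have hX0 : 0 < height P := one_pos.trans hX1
  refine ⟨P, ⟨hPn, absVal_pos.2 fun h0 => (hB₀ P hP.prime h0).not_gt hPB0, ?_⟩,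
    (le_max_left _ _).trans_lt hPB⟩
  have hα1 : absVal (ξ - α) ≤ 1 :=
    hα.le.trans (Real.rpow_le_one_of_one_le_of_nonpos hX1.le (by linarith))
  have hc := one_le_shiftConst n ξ
  calc absVal (evalAt P ξ) ≤ shiftConst n ξ * height P * absVal (ξ - α) :=
        absVal_evalAt_le_of_root hPn hP.evalAt_eq_zero hα1
    _ < height P ^ (w - w') * height P * height P ^ (-w - 1) := by
        refine mul_lt_mul'' ?_ hα (by positivity) hα0.le
        exact mul_lt_mul_of_pos_right (hB₁ _ hPB1.le) hX0
    _ = height P ^ (-w') := by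
        rw [← Real.rpow_add_one hX0.ne', ← Real.rpow_add hX0]
        congr 1; ring

theorem NewtonSimple.exists_root_absVal {f : (LaurentSeries F)[X]}
    (hf : NewtonSimple (absAV F) f) :
    ∃ y, f.eval y = 0 ∧ absVal (f.coeff 1) * absVal y = absVal (f.coeff 0) := by
  obtain ⟨v, hv, hext, hconj⟩ := exists_absoluteValue_algebraicClosure F
  exact hf.exists_root hv hext hconj

/-- The root of `R` closest to `ξ`. -/
theorem exists_algebraic_approximation {ξ : LaurentSeries F} {R : F[X][X]}
    (hR : NewtonSimple (absAV F) (shift ξ R)) (h0 : evalAt R ξ ≠ 0) {c : ℝ}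
    (hc : absVal (evalAt R ξ) < c * absVal ((shift ξ R).coeff 1)) :
    ∃ α, evalAt R α = 0 ∧ 0 < absVal (ξ - α) ∧ absVal (ξ - α) < c := by
  obtain ⟨y, hy0, hy⟩ := hR.exists_root_absVal
  have hp : 0 < absVal ((shift ξ R).coeff 1) := hR.coeff_one_pos
  have hv : absVal (ξ - (y + ξ)) = absVal y := by
    rw [sub_add_cancel_right]; exact (absAV F).map_neg y
  rw [shift_coeff_zero] at hy
  refine ⟨y + ξ, by rw [← shift_eval, hy0], ?_, ?_⟩
  · rw [hv, absVal_pos]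
    rintro rfl
    rw [absVal_zero, mul_zero] at hy
    exact h0 (absVal_pos.not.1 (by rw [← hy]; exact lt_irrefl _) |> not_not.1)
  · rw [hv]
    rw [← hy, mul_comm c] at hc
    exact lt_of_mul_lt_mul_left hc hp.le

end Exponents

/-! ### The four inequalities -/

section Theorem

open Polynomial

variable {F : Type*} [Field F] {p : ℕ} [Fact p.Prime] [CharP F p]

theorem evalAt_map_frobenius (P : F[X][X]) (ξ : LaurentSeries F) :
    evalAt (P.map (frobenius F[X] p)) (ξ ^ p) = evalAt P ξ ^ p := by
  have := charP_laurentSeries (F := F) p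
  have hcomp : (incl F).comp (frobenius F[X] p) =
      (frobenius (LaurentSeries F) p).comp (incl F) := by
    ext x <;> simp [frobenius_def]
  rw [evalAt, eval₂_map, hcomp, ← frobenius_def p ξ, ← frobenius_def p (evalAt P ξ), evalAt, hom_eval₂]

variable [Finite F]

/-- Algebraic elements of `F((T⁻¹))` are separable over `F(T)`. -/
theorem IsMinimalPolynomial.shift_coeff_one_ne_zero (p : ℕ) [Fact p.Prime] [CharP F p]
    {ξ : LaurentSeries F} {P : F[X][X]}
    (hP : IsMinimalPolynomial ξ P) : (shift ξ P).coeff 1 ≠ 0 := by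
  intro h0
  have hp : p ≠ 0 := (Fact.out : p.Prime).ne_zero
  -- A nonzero derivative vanishing at `ξ` would have too small a degree. So `P(X) = R(X^p)`, and
  -- the components of `R` vanish at `ξ` in smaller degree, hence are all zero.
  have hd : derivative P = 0 := by
    by_contra hne
    have h1 : evalAt (derivative P) ξ = 0 := by
      rw [shift, taylor_coeff_one, derivative_map, eval_map] at h0
      exact h0
    exact absurd (hP.natDegree_le _ hne h1) (not_le.2 (natDegree_derivative_lt hP.natDegree_pos.ne'))
  have hexp := expand_contract p hd hp
  set R := contract p P with hR
  have hR0 : evalAt R (ξ ^ p) = 0 := by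
    have := hP.evalAt_eq_zero
    rwa [← hexp, evalAt, eval₂_eq_eval_map, map_expand, expand_eval, ← eval₂_eq_eval_map] at this
  have hdeg : R.natDegree < P.natDegree := by
    have h1 : P.natDegree = R.natDegree * p := by rw [← natDegree_expand, hexp]
    have h2 := hP.natDegree_pos
    have h3 := (Fact.out : p.Prime).two_le
    rw [h1] at h2 ⊢
    have h4 : 0 < R.natDegree := Nat.pos_of_mul_pos_right h2
    nlinarith
  obtain ⟨Q, hQd, hQ⟩ := exists_frobenius_decomposition p R
  have hQ0 : ∀ i < p, Q i = 0 := by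
    intro i hi
    by_contra hne
    have h1 := absVal_evalAt_pow_le hQ ξ hi
    rw [hR0, absVal_zero] at h1
    have h2 : evalAt (Q i) ξ = 0 := by
      by_contra h
      exact absurd h1 (not_le.2 (pow_pos (absVal_pos.2 h) p))
    exact absurd (hP.natDegree_le _ hne h2) (not_le.2 ((hQd i).trans_lt hdeg))
  refine hP.ne_zero ?_
  rw [← hexp, hQ, Finset.sum_eq_zero, map_zero]
  intro i hi
  rw [hQ0 i (Finset.mem_range.1 hi)]
  simp

theorem height_map_frobenius (P : F[X][X]) : height (P.map (frobenius F[X] p)) = height P ^ p := by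
  have e : ∀ i, absVal (incl F ((P.map (frobenius F[X] p)).coeff i)) =
      absVal (incl F (P.coeff i)) ^ p := fun i => by
    rw [coeff_map, frobenius_def, map_pow, absVal_pow]
  apply le_antisymm
  · rw [height_le_iff]
    intro i
    rw [e]
    exact pow_le_pow_left₀ (absVal_nonneg _) (absVal_le_height P i) p
  · obtain ⟨i, hi⟩ := exists_absVal_eq_height P
    rw [hi, ← e]
    exact absVal_le_height _ i

theorem rpow_pow_comm {x : ℝ} (hx : 0 ≤ x) (y : ℝ) (k : ℕ) : (x ^ y) ^ k = (x ^ k) ^ y := by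
  rw [← Real.rpow_natCast, ← Real.rpow_natCast, ← Real.rpow_mul hx, ← Real.rpow_mul hx, mul_comm]

theorem wExp_le_wExp_pow (n : ℕ) (ξ : LaurentSeries F) : wExp n ξ ≤ wExp n (ξ ^ p) := by
  refine sSup_le_sSup (Set.image_mono fun w hw => ?_)
  have hinj : Function.Injective (fun P : F[X][X] => P.map (frobenius F[X] p)) :=
    map_injective _ (frobenius_inj F[X] p)
  refine (Set.Infinite.image hinj.injOn hw).mono ?_
  rintro _ ⟨P, ⟨h1, h2, h3⟩, rfl⟩
  refine ⟨natDegree_map_le.trans h1, ?_, ?_⟩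
  · rw [evalAt_map_frobenius, absVal_pow]
    positivity
  · rw [evalAt_map_frobenius, absVal_pow, height_map_frobenius,
      ← rpow_pow_comm (height_nonneg P)]
    exact pow_lt_pow_left₀ h3 h2.le (Fact.out : p.Prime).ne_zero

/-- A component not vanishing at `ξ` satisfies the same inequality. Its height might stay bounded as
that of `P` grows, but its value tends to `0`, so infinitely many components occur. -/
theorem wExp_pow_le_wExp {n : ℕ} (hn : 1 ≤ n) (ξ : LaurentSeries F) :
    wExp n (ξ ^ p) ≤ wExp n ξ := by
  have hp : p ≠ 0 := (Fact.out : p.Prime).ne_zero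
  refine sSup_coe_le (zero_le_wExp hn ξ) fun w hw hw0 => le_sSup ⟨w, fun hfin => ?_, rfl⟩
  obtain ⟨κ, hκ, -, hmin⟩ := exists_pos_le_of_finite hfin (fun P => absVal (evalAt P ξ))
    (fun P hP => hP.2.1)
  obtain ⟨B, hB1, hB⟩ := exists_rpow_ge hw0 (κ ^ p)⁻¹
  obtain ⟨P, ⟨hPn, hP0, hPv⟩, hPB⟩ := exists_le_height_of_infinite' hw (fun P hP => hP.1) B
  have hH0 : 0 < height P := (zero_lt_one.trans_le hB1).trans hPB
  obtain ⟨Q, hQd, hQ⟩ := exists_frobenius_decomposition p P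
  obtain ⟨i, hi, hQ0⟩ := exists_evalAt_ne_zero hQ (absVal_pos.1 hP0)
  have hQne : Q i ≠ 0 := fun h => hQ0 (by simp [h, evalAt])
  have h1 := (absVal_evalAt_pow_le hQ ξ hi).trans_lt hPv
  have h2 : κ ≤ absVal (evalAt (Q i) ξ) := by
    refine hmin (Q i) ⟨(hQd i).trans hPn, absVal_pos.2 hQ0, ?_⟩
    refine lt_of_pow_lt_pow_left₀ p (Real.rpow_nonneg (height_nonneg _) _) (h1.trans_le ?_)
    rw [rpow_pow_comm (height_nonneg _)]
    exact Real.rpow_le_rpow_of_nonpos (pow_pos (height_pos hQne) p) (height_pow_le hQ hi)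
      (by linarith)
  have h3 : κ ^ p < height P ^ (-w) := (pow_le_pow_left₀ hκ.le h2 p).trans_lt h1
  have h4 := hB _ hPB.le
  rw [Real.rpow_neg hH0.le] at h3
  exact absurd h4 (not_lt.2 ((le_inv_comm₀ (by positivity) (by positivity)).1 h3.le))

/-- Frobenius carries `α` to `α ^ p`. Minimality of the transformed polynomial need not be checked,
as `infinite_algebraic_approximations` accepts any annihilating one. -/
theorem wStarExp_le_wStarExp_pow {n : ℕ} (hn : 1 ≤ n) (ξ : LaurentSeries F) :
    wStarExp n ξ ≤ wStarExp n (ξ ^ p) := by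
  have hp : p ≠ 0 := (Fact.out : p.Prime).ne_zero
  have := charP_laurentSeries (F := F) p
  refine sSup_coe_le (zero_le_wStarExp hn _) fun w hw hw0 => le_sSup ⟨w, ?_, rfl⟩
  refine infinite_algebraic_approximations (by linarith) fun B => ?_
  obtain ⟨α, P, hP, hPn, ⟨hα0, hα⟩, hPB⟩ := exists_le_height_of_infinite hw B
  have hH := one_le_height hP.ne_zero
  have hsub : ξ ^ p - α ^ p = (ξ - α) ^ p := (sub_pow_char _ _).symm
  refine ⟨height P ^ p, hPB.le.trans (le_self_pow₀ hH hp), α ^ p, P.map (frobenius F[X] p),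
    (Polynomial.map_ne_zero_iff (frobenius_inj F[X] p)).2 hP.ne_zero, natDegree_map_le.trans hPn,
    ?_, (height_map_frobenius P).le, ?_, ?_⟩
  · rw [evalAt_map_frobenius, hP.evalAt_eq_zero, zero_pow hp]
  · rw [hsub, absVal_pow]; positivity
  · rw [hsub, absVal_pow, ← rpow_pow_comm (height_nonneg P)]
    exact pow_lt_pow_left₀ hα hα0.le hp

/-- The exponents `w_n` and `w_n^*` of an algebraic element of degree at most `n` coincide. -/
theorem wExp_le_wStarExp_of_algebraic (p : ℕ) [Fact p.Prime] [CharP F p] {n : ℕ} (hn : 1 ≤ n)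
    {ξ : LaurentSeries F} (halg : ∃ Q : F[X][X], Q ≠ 0 ∧ Q.natDegree ≤ n ∧ evalAt Q ξ = 0) :
    wExp n ξ ≤ wStarExp n ξ := by
  have hq := one_lt_card (F := F)
  refine sSup_coe_le (zero_le_wStarExp hn ξ) fun w hw hw0 => le_sSup_coe hw0 fun w' hw'0 hw' => ?_
  obtain ⟨Q, hQ0, hQn, hQξ⟩ := halg
  obtain ⟨Z, hZ, hZd, -⟩ := exists_isMinimalPolynomial_le hQ0 hQξ
  have hZn := hZd.trans hQn
  have hD := absVal_pos.2 (hZ.shift_coeff_one_ne_zero p)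
  set D := absVal ((shift ξ Z).coeff 1) with hDdef
  set c := shiftConst n ξ with hc
  have hc1 : 1 ≤ c := one_le_shiftConst n ξ
  -- Chosen so that `q ^ (N + 1) > m H` forces `q ^ (N + 1) D > c H`, which bounds the linear
  -- coefficient of `P`; `e` is the resulting loss in height.
  set m : ℝ := max 1 (c / D) with hm
  have hm1 : 1 ≤ m := le_max_left _ _
  have hZ1 := one_le_height hZ.ne_zero
  set e : ℝ := Nat.card F * m * height Z with he
  have he1 : 1 ≤ e := by
    rw [he]
    exact one_le_mul_of_one_le_of_one_le (one_le_mul_of_one_le_of_one_le hq.le hm1) hZ1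
  obtain ⟨B₁, hB₁1, hB₁⟩ := exists_rpow_ge (sub_pos.2 hw') (e ^ (w' + 1))
  refine infinite_algebraic_approximations (by linarith) fun B => ?_
  obtain ⟨P, ⟨hPn, hP0, hPv⟩, hPB⟩ :=
    exists_le_height_of_infinite' hw (fun P hP => hP.1) (max (max B B₁) (c * e))
  set H := height P with hH
  have hHB : B < H := (le_max_left _ _).trans_lt ((le_max_left _ _).trans_lt hPB)
  have hHB1 : B₁ < H := (le_max_right _ _).trans_lt ((le_max_left _ _).trans_lt hPB)
  have hHc : c * e < H := (le_max_right _ _).trans_lt hPB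
  have hH1 : 1 < H := hB₁1.trans_lt hHB1
  have hH0 : 0 < H := one_pos.trans hH1
  obtain ⟨N, hN1, hN2⟩ := exists_nat_pow_near
    (one_le_mul_of_one_le_of_one_le hm1 hH1.le) hq
  have hN3 : (Nat.card F : ℝ) ^ (N + 1) ≤ Nat.card F * m * H := by
    rw [pow_succ', mul_assoc]; gcongr
  have hcD : c * H < (Nat.card F : ℝ) ^ (N + 1) * D := by
    have h1 : c / D * H ≤ m * H := mul_le_mul_of_nonneg_right (le_max_right _ _) hH0.le
    have h2 := h1.trans_lt hN2
    rwa [div_mul_eq_mul_div, div_lt_iff₀ hD] at h2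
  -- `R` has the value of `P` at `ξ`, but a derivative larger than `H`, so its closest root gains
  -- the extra factor `H⁻¹` that `w_n^*` requires.
  set R := P + C (X ^ (N + 1)) * Z with hRdef
  have hRn : R.natDegree ≤ n :=
    (natDegree_add_le _ _).trans (max_le hPn ((natDegree_C_mul_le _ _).trans hZn))
  have hRh : height R ≤ e * H := by
    refine height_add_le (le_mul_of_one_le_left hH0.le he1) (height_le_iff.2 fun i => ?_)
    rw [coeff_C_mul, map_mul, absVal_mul, absVal_incl_X_pow]
    calc _ ≤ (Nat.card F * m * H) * height Z :=
          mul_le_mul hN3 (absVal_le_height Z i) (absVal_nonneg _) (by positivity)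
      _ = e * H := by rw [he]; ring
  have hRξ : evalAt R ξ = evalAt P ξ := by
    have := hZ.evalAt_eq_zero
    rw [evalAt] at this
    rw [hRdef, evalAt, eval₂_add, eval₂_mul, this, mul_zero, add_zero, evalAt]
  have hR1 : absVal ((shift ξ R).coeff 1) = (Nat.card F : ℝ) ^ (N + 1) * D := by
    have hterm : absVal ((shift ξ (C (X ^ (N + 1)) * Z)).coeff 1) =
        (Nat.card F : ℝ) ^ (N + 1) * D := by
      rw [shift, Polynomial.map_mul, map_C, taylor_mul, taylor_C, coeff_C_mul, absVal_mul,
        absVal_incl_X_pow, hDdef, shift]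
    rw [← hterm, hRdef, shift_add, coeff_add, add_comm]
    refine add_eq_left_of_lt isNonarchimedean_absAV ?_
    rw [absAV_apply, absAV_apply, hterm]
    exact (absVal_shift_coeff_le ξ hPn 1).trans_lt hcD
  have hR1H : H < absVal ((shift ξ R).coeff 1) := by
    rw [hR1]
    exact (le_mul_of_one_le_left hH0.le hc1).trans_lt hcD
  have hv1 : absVal (evalAt R ξ) ≤ 1 := by
    rw [hRξ]
    exact hPv.le.trans (Real.rpow_le_one_of_one_le_of_nonpos hH1.le (by linarith))
  -- All coefficients are at most `c e H < H ^ 2`, the value is at most `1`, and the linear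
  -- coefficient exceeds `H > 1`.
  have hNS : NewtonSimple (absAV F) (shift ξ R) := by
    refine ⟨fun h0 => ?_, fun k hk => ?_⟩
    · rw [h0, absVal_zero] at hR1H
      exact absurd hR1H (not_lt.2 hH0.le)
    · rw [shift_coeff_zero]
      simp only [absAV_apply]
      calc absVal ((shift ξ R).coeff k) * absVal (evalAt R ξ) ^ (k - 1)
          ≤ (c * (e * H)) * 1 := by
            refine mul_le_mul ((absVal_shift_coeff_le ξ hRn k).trans ?_)
              (pow_le_one₀ (absVal_nonneg _) hv1) (pow_nonneg (absVal_nonneg _) _) (by positivity)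
            exact mul_le_mul_of_nonneg_left hRh (by positivity)
        _ = c * e * H := by ring
        _ ≤ H * H := mul_le_mul_of_nonneg_right hHc.le hH0.le
        _ < absVal ((shift ξ R).coeff 1) ^ 2 := by
            rw [← sq]; exact pow_lt_pow_left₀ hR1H hH0.le two_ne_zero
        _ ≤ _ := pow_le_pow_right₀ (hH1.trans hR1H).le hk
  obtain ⟨α, hα, hα0, hαlt⟩ := exists_algebraic_approximation (c := H ^ (-w - 1)) hNS
    (by rw [hRξ]; exact absVal_pos.1 hP0) (by
      rw [hRξ]
      refine hPv.trans ?_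
      have : H ^ (-w) = H ^ (-w - 1) * H := by
        rw [← Real.rpow_add_one hH0.ne']; congr 1; ring
      rw [this]
      exact mul_lt_mul_of_pos_left hR1H (by positivity))
  refine ⟨e * H, hHB.le.trans (le_mul_of_one_le_left hH0.le he1), α, R, ?_, hRn, hα, hRh, hα0,
    hαlt.trans ?_⟩
  · rintro h0
    rw [h0] at hRξ
    rw [← hRξ] at hP0
    simp [evalAt, absVal_zero] at hP0
  · have h1 := hB₁ H hHB1.le
    have e1 : (e * H) ^ (-w' - 1) = (e ^ (w' + 1))⁻¹ * H ^ (-w' - 1) := by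
      rw [Real.mul_rpow (by positivity) hH0.le, ← Real.rpow_neg (by positivity)]
      congr 2; ring
    rw [e1, ← div_eq_inv_mul, lt_div_iff₀ (by positivity)]
    calc H ^ (-w - 1) * e ^ (w' + 1) < H ^ (-w - 1) * H ^ (w - w') := by gcongr
      _ = H ^ (-w' - 1) := by rw [← Real.rpow_add hH0]; congr 1; ring

theorem wStarExp_pow_le_wStarExp {n : ℕ} (hn : 1 ≤ n) (ξ : LaurentSeries F) :
    wStarExp n (ξ ^ p) ≤ wStarExp n ξ := by
  by_cases halg : ∃ Q : F[X][X], Q ≠ 0 ∧ Q.natDegree ≤ n ∧ evalAt Q ξ = 0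
  · exact (wStarExp_le_wExp hn _).trans ((wExp_pow_le_wExp hn ξ).trans
      (wExp_le_wStarExp_of_algebraic p hn halg))
  push Not at halg
  have hp : p ≠ 0 := (Fact.out : p.Prime).ne_zero
  have hp' : (p : ℝ) ≠ 0 := Nat.cast_ne_zero.2 hp
  -- `ξ ^ p` inherits from `ξ` that no such polynomial annihilates it: all components of one that
  -- did would vanish at `ξ`.
  have hζ : ∀ Q : F[X][X], Q ≠ 0 → Q.natDegree ≤ n → evalAt Q (ξ ^ p) ≠ 0 := by
    intro P hP hPn h0
    obtain ⟨Q, hQd, hQ⟩ := exists_frobenius_decomposition p P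
    refine hP ?_
    rw [hQ]
    refine Finset.sum_eq_zero fun i hi => ?_
    have h1 := absVal_evalAt_pow_le hQ ξ (Finset.mem_range.1 hi)
    rw [h0, absVal_zero] at h1
    have h2 : Q i = 0 := by
      by_contra hne
      exact absurd h1 (not_le.2 (pow_pos (absVal_pos.2 (halg _ hne ((hQd i).trans hPn))) p))
    rw [h2]; simp
  refine sSup_coe_le (zero_le_wStarExp hn ξ) fun w hw hw0 => le_sSup ⟨w, ?_, rfl⟩
  refine infinite_algebraic_approximations (by linarith) fun B => ?_
  -- The components live at height `Z = Y ^ (1/p)`, hence the `p`-th power in the bound; the maximum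
  -- with `1` keeps its base nonnegative.
  obtain ⟨Y, hBY, hY1, R, hRn, hRh, hNS, hRv⟩ :=
    exists_newtonSimple_of_infinite hn hζ hw0 hw (max B 1 ^ p)
  have hY0 : 0 < Y := one_pos.trans hY1
  set Z := Y ^ ((p : ℝ)⁻¹) with hZ
  have hZ0 : 0 < Z := by positivity
  have hZp : Z ^ p = Y := Real.rpow_inv_natCast_pow hY0.le hp
  obtain ⟨Q, hQd, hQ⟩ := exists_frobenius_decomposition p R
  obtain ⟨i, hi, hNSi, hvi⟩ := exists_newtonSimple_component hQ hNS (c := Z ^ (-w - 1))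
    (by rwa [rpow_pow_comm hZ0.le, hZp]) (by positivity)
  have hQne : Q i ≠ 0 := by
    intro h0
    exact hNSi.1 (by rw [h0]; simp [shift])
  have hQn := (hQd i).trans hRn
  obtain ⟨α, hα, hα0, hαlt⟩ := exists_algebraic_approximation hNSi (halg _ hQne hQn) hvi
  refine ⟨Z, ?_, α, Q i, hQne, hQn, hα, ?_, hα0, hαlt⟩
  · refine (le_max_left B 1).trans (le_of_pow_le_pow_left₀ hp hZ0.le ?_)
    rwa [hZp]
  · refine le_of_pow_le_pow_left₀ hp hZ0.le ?_
    rw [hZp]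
    exact (height_pow_le hQ hi).trans hRh

end Theorem

end MahlerKoksma

end

theorem theorem1p6 {F : Type*} [Field F] [Finite F] (p : ℕ) [Fact p.Prime] [CharP F p]
    (ξ : LaurentSeries F) (n : ℕ) (hn : 1 ≤ n) :
    MahlerKoksma.wExp n ξ = MahlerKoksma.wExp n (ξ ^ p) ∧
      MahlerKoksma.wStarExp n ξ = MahlerKoksma.wStarExp n (ξ ^ p) :=
  ⟨le_antisymm (MahlerKoksma.wExp_le_wExp_pow n ξ) (MahlerKoksma.wExp_pow_le_wExp hn ξ),
    le_antisymm (MahlerKoksma.wStarExp_le_wStarExp_pow hn ξ)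
      (MahlerKoksma.wStarExp_pow_le_wStarExp hn ξ)⟩
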